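/- A nontrivial element $g$ of a group $G$ is called a generalized torsion element if some nonempty finite product of conjugates of $g$ in $G$ is the identity. For an integer $n\ge 1$, the $(-n)$-twist knot is the knot in $S^3$ obtained from a twist region, in which two strands make $n$ left-handed full twists ($2n$ crossings), by joining the two left ends and the two right ends into two arcs that are hooked by a clasp (two crossings); the clasp is chosen so that the $(-1)$-twist knot is the right-handed trefoil (while one right-handed full twist with the same clasp would give the figure-eight knot). Theorem. For every integer $n\ge 1$ and every $(-n)$-twist knot $K\subset S^3$ (that is, every $K$ ambient isotopic to the standard one), the knot group $\pi_1(S^3-K)$, at any base point, contains a generalized torsion element. -/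

import Mathlib

namespace TwistKnot

/-- A nontrivial element of a group some nonempty finite product of whose conjugates
`h⁻¹ * g * h` is the identity. -/
def IsGeneralizedTorsion {G : Type*} [Group G] (g : G) : Prop :=
  g ≠ 1 ∧ ∃ l : List G, l ≠ [] ∧ (l.map fun h => h⁻¹ * g * h).prod = 1

/-- Euclidean 3-space. -/
abbrev E3 : Type := EuclideanSpace ℝ (Fin 3)

/-- The 3-sphere: the unit sphere of Euclidean 4-space. -/
abbrev S3 : Type := Metric.sphere (0 : EuclideanSpace ℝ (Fin 4)) 1

/-- The inverse stereographic projection from the north pole `(0, 0, 0, 1)`. -/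
noncomputable def invStereo (p : E3) : S3 :=
  ⟨(‖p‖ ^ 2 + 1)⁻¹ • !₂[2 * p 0, 2 * p 1, 2 * p 2, ‖p‖ ^ 2 - 1], by
    have h : ‖p‖ ^ 2 = p 0 ^ 2 + p 1 ^ 2 + p 2 ^ 2 := by
      simp [EuclideanSpace.norm_sq_eq, Fin.sum_univ_three]
    have hpos : (0 : ℝ) < ‖p‖ ^ 2 + 1 := by positivity
    have hv : ‖(!₂[2 * p 0, 2 * p 1, 2 * p 2, ‖p‖ ^ 2 - 1] : EuclideanSpace ℝ (Fin 4))‖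
        = ‖p‖ ^ 2 + 1 := by
      rw [← sq_eq_sq₀ (norm_nonneg _) hpos.le, EuclideanSpace.norm_sq_eq]
      simp only [Fin.sum_univ_four, Real.norm_eq_abs, sq_abs]
      simp
      linear_combination (-4 : ℝ) * h
    rw [mem_sphere_zero_iff_norm, norm_smul, hv, Real.norm_of_nonneg (inv_nonneg.2 hpos.le),
      inv_mul_cancel₀ hpos.ne']⟩

/-- A horizontal edge of the diagram: the straight segment in the plane `z = 0` at height `y = r`
from `x = c₁` to `x = c₂`. -/
def rowEdge (r c₁ c₂ : ℝ) : Set E3 :=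
  segment ℝ !₂[c₁, r, 0] !₂[c₂, r, 0]

/-- A vertical edge of the diagram: the straight segment in the plane `z = 1` at `x = c` from
`y = r₁` to `y = r₂`, together with the two segments joining its ends to the plane `z = 0`.
Seen from `z = +∞`, vertical edges thus pass over horizontal edges. -/
def colEdge (c r₁ r₂ : ℝ) : Set E3 :=
  segment ℝ !₂[c, r₁, 0] !₂[c, r₁, 1] ∪ segment ℝ !₂[c, r₁, 1] !₂[c, r₂, 1] ∪
    segment ℝ !₂[c, r₂, 1] !₂[c, r₂, 0]

/-- The standard diagram of the `(-n)`-twist knot, `1 ≤ n`, drawn on a square grid with vertical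
edges over horizontal ones, as a closed polygon in 3-space.

* Twist region: crossings at `(k, k)` for `1 ≤ k ≤ 2 * n`. Two strands run from the lower left to
  the upper right and cross `2 * n` times, alternately over and under, which gives `n` left-handed
  full twists. The strands have the two left ends `(1, 0)`, `(0, 1)` and the two right ends
  `(2 * n, 2 * n + 1)`, `(2 * n + 1, 2 * n)`.
* Clasp: crossings at `(2 * n + 2, 2 * n + 2)` and `(2 * n + 3, 2 * n + 3)`. The two left ends of
  the twist region are joined to the arc entering the clasp from the upper left, the
  two right ends to the arc entering it from the lower right; these two arcs are hooked.

The picture is the case `n = 1` (the right-handed trefoil); the rows are `y = 6, …, 0` and the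
columns `x = -1, …, 6`.
```
  6  +-----------------------+
     |                       |
  5  |               +-------|---+
     |               |       |   |
  4  |   +-----------|-------+   |
     |   |           |           |
  3  |   |       +---+           |
     |   |       |               |
  2  |   |   +---|---------------+
     |   |   |   |
  1  |   +---|---+
     |       |
  0  +-------+
    -1   0   1   2   4       5   6
```
-/
def negTwistPolygon (n : ℕ) : Set E3 :=
  -- the twist region, and the edge joining one of its right ends to the clasp
  (⋃ k ∈ Finset.Icc 1 (2 * n), colEdge k (k - 1) (k + 1)) ∪
  (⋃ k ∈ Finset.Icc 1 (2 * n - 1), rowEdge k (k - 1) (k + 1)) ∪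
  rowEdge (2 * n) (2 * n - 1) (2 * n + 4) ∪
  rowEdge (2 * n + 1) (2 * n) (2 * n + 2) ∪
  -- the clasp
  colEdge (2 * n + 2) (2 * n + 1) (2 * n + 3) ∪
  rowEdge (2 * n + 2) 0 (2 * n + 3) ∪
  colEdge (2 * n + 3) (2 * n + 2) (2 * n + 4) ∪
  rowEdge (2 * n + 3) (2 * n + 2) (2 * n + 4) ∪
  -- the other three connecting arcs: on the right, on the left, and around the outside
  colEdge (2 * n + 4) (2 * n) (2 * n + 3) ∪
  colEdge 0 1 (2 * n + 2) ∪
  rowEdge (2 * n + 4) (-1) (2 * n + 3) ∪ colEdge (-1) 0 (2 * n + 4) ∪ rowEdge 0 (-1) 1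

/-- The standard `(-n)`-twist knot in the 3-sphere. -/
noncomputable def stdNegTwistKnot (n : ℕ) : Set S3 :=
  invStereo '' negTwistPolygon n

/-- `K` is carried to `K'` by an ambient isotopy of the 3-sphere. -/
def AmbientIsotopic (K K' : Set S3) : Prop :=
  ∃ F : unitInterval → (S3 ≃ₜ S3), Continuous (fun p : unitInterval × S3 => F p.1 p.2) ∧
    F 0 = Homeomorph.refl S3 ∧ F 1 '' K = K'

/-- `K` is a `(-n)`-twist knot: it has the knot type of the standard one. -/
def IsNegTwistKnot (n : ℕ) (K : Set S3) : Prop :=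
  AmbientIsotopic (stdNegTwistKnot n) K

/-- The knot group: the fundamental group of the complement in the 3-sphere. -/
abbrev KnotGroup (K : Set S3) (x₀ : (Kᶜ : Set S3)) : Type :=
  FundamentalGroup (Kᶜ : Set S3) x₀

end TwistKnot

/-! Let `a` and `u` be the classes of two loops through faces of the standard diagram, and put R =
uⁿau⁻ⁿ. In the knot group a⁻¹Ra = u⁻¹R. The generalized torsion element is g = a⁻¹uau⁻¹.

Call x positive if it is a nonempty product of conjugates of g, and write y > x if yx⁻¹ is positive;
this relation is compatible with multiplication on both sides. The elements v_k = a⁻ᵏuaᵏ increase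
with k, so D_k = v_kⁿ v_{k-1}⁻ⁿ is positive. The knot relation says that D_k = v_k D_{k+1}.
Iterating it in both directions shows that D_k > v_kᵐ and that v_{k-1}ᵐ D_k is positive, for every
m. With m = n, the first at k = 1 and the second at k = 0 make v_0⁻ⁿ and v_0ⁿ positive, and so is
their product 1 (`isConjProd_one_of_relation`).

That g ≠ 1 is seen in the dihedral group of order 2(4n - 1): `a` goes to a reflection, `u` to the
rotation by 1, and g to the rotation by -2.

No presentation of the knot group is computed; it is enough that the relation holds and that the
dihedral representation exists. Both are expressed by labelings of the faces of a grid diagram.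
Explicit loops through the faces satisfy the face and crossing relations, since the homotopies take
place in convex sets off the link (`isFaceLabeling_cellElement`). Conversely, a labeling by
permutations glues a covering space of the complement from three charts, and its monodromy returns
the labels up to a common conjugation (`IsFaceLabeling.exists_hom`). All this is done for any open
embedding of 3-space with path connected link complement, so that an ambient isotopy enters only
through its final homeomorphism. -/

namespace TwistKnot

/-! ### Generalized torsion from the knot relation. -/

section ConjugateProducts

variable {G : Type*} [Group G]

/-- `x` is a nonempty finite product of conjugates of `g`. -/
def IsConjProd (g x : G) : Prop :=
  ∃ l : List G, l ≠ [] ∧ (l.map fun h => h⁻¹ * g * h).prod = x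

namespace IsConjProd

variable {g x y z w : G}

theorem self (g : G) : IsConjProd g g := ⟨[1], by simp, by simp⟩

theorem mul (hx : IsConjProd g x) (hy : IsConjProd g y) : IsConjProd g (x * y) := by
  obtain ⟨l, hl, rfl⟩ := hx
  obtain ⟨l', -, rfl⟩ := hy
  exact ⟨l ++ l', by simp [hl], by simp⟩

theorem conj (hx : IsConjProd g x) (c : G) : IsConjProd g (c⁻¹ * x * c) := by
  obtain ⟨l, hl, rfl⟩ := hx
  refine ⟨l.map (· * c), by simpa using hl, ?_⟩
  clear hl
  induction l with
  | nil => simp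
  | cons h t ih =>
    simp only [List.map_cons, List.prod_cons] at ih ⊢
    rw [ih]; group

/-- Products of conjugates are the positive elements of a bi-invariant preorder. -/
theorem mul_mul_inv (h₁ : IsConjProd g (y * x⁻¹)) (h₂ : IsConjProd g (w * z⁻¹)) :
    IsConjProd g (y * w * (x * z)⁻¹) := by
  have := (h₂.conj y⁻¹).mul h₁
  convert this using 1; group

theorem mul_left_mul_inv (c : G) (h : IsConjProd g (w * z⁻¹)) :
    IsConjProd g (c * w * (c * z)⁻¹) := by
  have := h.conj c⁻¹
  convert this using 1; group

theorem pow_mul_pow_inv (h : IsConjProd g (y * x⁻¹)) {m : ℕ} (hm : 1 ≤ m) :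
    IsConjProd g (y ^ m * (x ^ m)⁻¹) := by
  induction m, hm using Nat.le_induction with
  | base => simpa using h
  | succ m _ ih => rw [pow_succ, pow_succ]; exact ih.mul_mul_inv h

end IsConjProd

/-- In a group in which `u` and `a` satisfy the relation of the `(-n)`-twist knot, the commutator of
`a⁻¹` and `u` is annihilated by a product of conjugates. -/
theorem isConjProd_one_of_relation {n : ℕ} (hn : 1 ≤ n) (a u : G)
    (hrel : a⁻¹ * (u ^ n * a * (u ^ n)⁻¹) * a = u⁻¹ * (u ^ n * a * (u ^ n)⁻¹)) :
    IsConjProd (a⁻¹ * u * a * u⁻¹) 1 := by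
  set g := a⁻¹ * u * a * u⁻¹ with hg
  let v : ℤ → G := fun k => (a ^ k)⁻¹ * u * a ^ k
  let D : ℤ → G := fun k => v k ^ n * (v (k - 1) ^ n)⁻¹
  have hvconj (c : ℤ) (k : ℤ) (m : ℕ) : (a ^ c)⁻¹ * v k ^ m * a ^ c = v (k + c) ^ m := by
    have : v (k + c) = (a ^ c)⁻¹ * v k * (a ^ c)⁻¹⁻¹ := by
      simp only [v, zpow_add]; group
    rw [this, conj_pow]; simp
  have hlt (k : ℤ) : IsConjProd g (v (k + 1) * (v k)⁻¹) := by
    have := (IsConjProd.self g).conj (a ^ k)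
    convert this using 1
    simp only [v, hg, zpow_add]; group
  have hlt' (k : ℤ) : IsConjProd g (v k * (v (k - 1))⁻¹) := by
    have := hlt (k - 1)
    rwa [sub_add_cancel] at this
  have hD (k : ℤ) : IsConjProd g (D k) := (hlt' k).pow_mul_pow_inv hn
  -- The only use of `hrel`; `h3` below is that relation multiplied on the right by a⁻².
  have hrec0 : D 0 = v 0 * D 1 := by
    have h1 : v 1 ^ n = a⁻¹ * u ^ n * a := by
      have := hvconj 1 0 n
      simpa [v] using this.symm
    have h2 : v (-1) ^ n = a * u ^ n * a⁻¹ := by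
      simp [v]
    have h0 : v 0 = u := by simp [v]
    simp only [D, zero_sub, sub_self, h0, h1, h2]
    have h3 : u⁻¹ * (u ^ n * a * (u ^ n)⁻¹) * a⁻¹ = a⁻¹ * (u ^ n * a * (u ^ n)⁻¹) := by
      rw [← hrel]; group
    calc u ^ n * (a * u ^ n * a⁻¹)⁻¹ = u * (u⁻¹ * (u ^ n * a * (u ^ n)⁻¹) * a⁻¹) := by group
      _ = u * (a⁻¹ * u ^ n * a * (u ^ n)⁻¹) := by rw [h3]; group
  -- Conjugation by `a ^ k` shifts all indices by `k`.
  have hrec (k : ℤ) : D k = v k * D (k + 1) := by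
    have h := congrArg (fun x => (a ^ k)⁻¹ * x * a ^ k) hrec0
    have e0 := hvconj k 0 n
    have e1 := hvconj k 1 n
    have e2 := hvconj k (-1) n
    have e3 := hvconj k 0 1
    simp only [pow_one, zero_add] at e0 e1 e2 e3
    have l1 : (a ^ k)⁻¹ * D 0 * a ^ k = D k := by
      simp only [D]
      rw [show k - 1 = -1 + k by ring, ← e0, ← e2, zero_sub]; group
    have l2 : (a ^ k)⁻¹ * (v 0 * D 1) * a ^ k = v k * D (k + 1) := by
      simp only [D]
      rw [show k + 1 - 1 = k by ring, show k + 1 = 1 + k by ring, ← e1, ← e0, ← e3, sub_self]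
      group
    rw [← l1, ← l2]; exact h
  -- Induction through D_{k+1} > v_{k+1}ᵐ > v_kᵐ, multiplied on the left by v_k. The case m = 0 is
  -- separate in the step because equal powers are not strictly comparable.
  have hlow (m : ℕ) : ∀ k, IsConjProd g (D k * (v k ^ m)⁻¹) := by
    induction m with
    | zero => intro k; simpa using hD k
    | succ m ih =>
      intro k
      have h1 : IsConjProd g (D (k + 1) * (v k ^ m)⁻¹) := by
        rcases Nat.eq_zero_or_pos m with rfl | hm
        · simpa using hD (k + 1)
        · have := (ih (k + 1)).mul ((hlt k).pow_mul_pow_inv hm)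
          simpa [mul_assoc] using this
      have := h1.mul_left_mul_inv (v k)
      rwa [← hrec, ← pow_succ'] at this
  -- The same recursion downwards: one factor v_{k-1} is absorbed into D_k to give D_{k-1}, and
  -- v_{k-1}ᵐ > v_{k-2}ᵐ.
  have hup (m : ℕ) : ∀ k, IsConjProd g (v (k - 1) ^ m * D k) := by
    induction m with
    | zero => intro k; simpa using hD k
    | succ m ih =>
      intro k
      have h1 : IsConjProd g (v (k - 1) ^ m * D (k - 1)) := by
        have h2 := ih (k - 1)
        rcases Nat.eq_zero_or_pos m with rfl | hm
        · simpa using h2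
        · have := ((hlt' (k - 1)).pow_mul_pow_inv hm).mul h2
          simpa [mul_assoc] using this
      rw [hrec (k - 1), sub_add_cancel] at h1
      rw [pow_succ, mul_assoc]; exact h1
  -- For m = n the power cancels a factor of D_1 up to conjugation.
  have hneg : IsConjProd g (v 0 ^ n)⁻¹ := by
    have := ((hlow n 1).conj (v 1 ^ n))
    convert this using 1
    simp only [D, sub_self]; group
  have hpos : IsConjProd g (v 0 ^ n) := by
    have := ((hup n 0).conj (v (-1) ^ n))
    convert this using 1
    simp only [D, zero_sub]; group
  simpa using hpos.mul hneg

end ConjugateProducts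

end TwistKnot

/-! ### Face labelings of grid diagrams and the relation of the twist knot. -/

namespace TwistKnot

/-- A link diagram on the square grid, with vertical edges over horizontal ones: `vert i j` is the
unit edge from `(i, j)` to `(i, j + 1)`, `horiz i j` the one from `(i, j)` to `(i + 1, j)`, and
`post i j` says that `(i, j)` is a corner of the diagram. -/
structure GridDiagram where
  vert : ℤ → ℤ → Prop
  horiz : ℤ → ℤ → Prop
  post : ℤ → ℤ → Prop
  bound : ℤ
  vert_bound : ∀ i j, vert i j → (-bound ≤ i ∧ i ≤ bound) ∧ -bound ≤ j ∧ j + 1 ≤ bound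
  horiz_bound : ∀ i j, horiz i j → (-bound ≤ i ∧ i + 1 ≤ bound) ∧ -bound ≤ j ∧ j ≤ bound
  post_bound : ∀ i j, post i j → (-bound ≤ i ∧ i ≤ bound) ∧ -bound ≤ j ∧ j ≤ bound

/-- A labeling of the unit cells `[i, i + 1] × [j, j + 1]` of the grid by elements of a group that
is constant on the faces of the diagram, trivial on the outer face, and satisfies the crossing
relations. Such labelings correspond to homomorphisms from the knot group. -/
structure GridDiagram.IsFaceLabeling (D : GridDiagram) {G : Type*} [Group G] (P : ℤ → ℤ → G) :
    Prop where
  vert : ∀ i j, ¬ D.vert i j → P (i - 1) j = P i j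
  horiz : ∀ i j, ¬ D.horiz i j → P i (j - 1) = P i j
  cross : ∀ i j, ¬ D.post i j →
    (P (i - 1) j)⁻¹ * P i j = (P (i - 1) (j - 1))⁻¹ * P i (j - 1)
  outer : ∀ i j, i < -D.bound ∨ D.bound ≤ i ∨ j < -D.bound ∨ D.bound ≤ j → P i j = 1

theorem GridDiagram.IsFaceLabeling.map {D : GridDiagram} {G H : Type*} [Group G] [Group H]
    {P : ℤ → ℤ → G} (hP : D.IsFaceLabeling P) (f : G →* H) :
    D.IsFaceLabeling fun i j => f (P i j) where
  vert i j h := by rw [hP.vert i j h]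
  horiz i j h := by rw [hP.horiz i j h]
  cross i j h := by simp only [← map_inv, ← map_mul, hP.cross i j h]
  outer i j h := by rw [hP.outer i j h, map_one]

/-- The diagram of the standard `(-n)`-twist knot. -/
def twistDiagram (n : ℕ) : GridDiagram where
  vert i j := (1 ≤ i ∧ i ≤ 2 * n ∧ i - 1 ≤ j ∧ j ≤ i) ∨
    (i = 2 * n + 2 ∧ 2 * n + 1 ≤ j ∧ j ≤ 2 * n + 2) ∨
    (i = 2 * n + 3 ∧ 2 * n + 2 ≤ j ∧ j ≤ 2 * n + 3) ∨
    (i = 2 * n + 4 ∧ 2 * n ≤ j ∧ j ≤ 2 * n + 2) ∨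
    (i = 0 ∧ 1 ≤ j ∧ j ≤ 2 * n + 1) ∨ (i = -1 ∧ 0 ≤ j ∧ j ≤ 2 * n + 3)
  horiz i j := (1 ≤ j ∧ j ≤ 2 * n - 1 ∧ j - 1 ≤ i ∧ i ≤ j) ∨
    (j = 2 * n ∧ 2 * n - 1 ≤ i ∧ i ≤ 2 * n + 3) ∨
    (j = 2 * n + 1 ∧ 2 * n ≤ i ∧ i ≤ 2 * n + 1) ∨
    (j = 2 * n + 2 ∧ 0 ≤ i ∧ i ≤ 2 * n + 2) ∨
    (j = 2 * n + 3 ∧ 2 * n + 2 ≤ i ∧ i ≤ 2 * n + 3) ∨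
    (j = 2 * n + 4 ∧ -1 ≤ i ∧ i ≤ 2 * n + 2) ∨ (j = 0 ∧ -1 ≤ i ∧ i ≤ 0)
  post i j := (1 ≤ i ∧ i ≤ 2 * n ∧ (j = i - 1 ∨ j = i + 1)) ∨
    (i = 2 * n + 2 ∧ (j = 2 * n + 1 ∨ j = 2 * n + 3)) ∨
    (i = 2 * n + 3 ∧ (j = 2 * n + 2 ∨ j = 2 * n + 4)) ∨
    (i = 2 * n + 4 ∧ (j = 2 * n ∨ j = 2 * n + 3)) ∨
    (i = 0 ∧ (j = 1 ∨ j = 2 * n + 2)) ∨ (i = -1 ∧ (j = 0 ∨ j = 2 * n + 4))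
  bound := 2 * n + 4
  vert_bound i j h := by omega
  horiz_bound i j h := by omega
  post_bound i j h := by omega

variable {G : Type*} [Group G]

/-- In a labeling of the twist knot diagram, the labels satisfy the relation of the knot group. -/
theorem GridDiagram.IsFaceLabeling.twist_relation {n : ℕ} (hn : 1 ≤ n) {P : ℤ → ℤ → G}
    (hP : (twistDiagram n).IsFaceLabeling P) {a u : G} (ha : a = P (-1) 0) (hu : u = P 0 1) :
    a⁻¹ * (u ^ n * a * (u ^ n)⁻¹) * a = u⁻¹ * (u ^ n * a * (u ^ n)⁻¹) := by
  have hV (i j : ℤ) (h : ¬ (twistDiagram n).vert i j) : P (i - 1) j = P i j := hP.vert i j h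
  have hH (i j : ℤ) (h : ¬ (twistDiagram n).horiz i j) : P i (j - 1) = P i j := hP.horiz i j h
  have hC (i j : ℤ) (h : ¬ (twistDiagram n).post i j) := hP.cross i j h
  have hO (i j : ℤ) := hP.outer i j
  simp only [twistDiagram] at hV hH hC hO
  have left (j : ℕ) (hj : (j : ℤ) ≤ 2 * n + 3) : P (-1) j = a := by
    induction j with
    | zero => simpa using ha.symm
    | succ j ih =>
      rw [← ih (by omega), ← hH (-1) (j + 1 : ℕ) (by omega)]
      congr 1; push_cast; ring
  -- The cells above the diagonal of the twist region form one face.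
  have face (i : ℕ) : ∀ j : ℕ, i < j → (i : ℤ) ≤ 2 * n - 1 → (j : ℤ) ≤ 2 * n + 1 → P i j = u := by
    induction i with
    | zero =>
      intro j hj
      induction j, hj using Nat.le_induction with
      | base => intros; simpa using hu.symm
      | succ j hj ih =>
        intro h1 h2
        rw [← ih h1 (by omega), ← hH _ (j + 1 : ℕ) (by omega)]
        congr 1; push_cast; ring
    | succ i ih =>
      intro j hj h1 h2
      rw [← ih j (by omega) (by omega) h2, ← hV (i + 1 : ℕ) j (by omega)]
      congr 1; push_cast; ring
  have lower (k : ℕ) (h1 : 1 ≤ k) (h2 : k ≤ 2 * n) : P k (k - 1) = 1 := by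
    have key (m : ℕ) : (m : ℤ) ≤ k - 1 → P k m = 1 := by
      induction m with
      | zero =>
        intro _
        rw [← hO k (-(2 * n + 4) - 1) (by omega)]
        have below (m : ℕ) : P k ((0 : ℕ) - m : ℤ) = P k (0 : ℕ) := by
          induction m with
          | zero => simp
          | succ m ih =>
            rw [← ih, ← hH k ((0 : ℕ) - m) (by omega)]
            congr 1; push_cast; ring
        -- From row 0, `2 * n + 5` steps down reach the first row below the bound.
        rw [← below (2 * n + 5)]
        push_cast; ring_nf
      | succ m ih =>
        intro hm
        rw [← ih (by omega), ← hH k (m + 1 : ℕ) (by omega)]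
        congr 1; push_cast; ring
    have := key (k - 1) (by omega)
    rwa [Nat.cast_sub h1, Nat.cast_one] at this
  have diag0 : P 0 0 = a := by
    rw [ha]; exact (hV 0 0 (by omega)).symm
  -- Each twist crossing has the face of `u` on its upper left and the outer face on its lower
  -- right.
  have step (k : ℕ) (h1 : 1 ≤ k) (h2 : k ≤ 2 * n) :
      P k k = u * (P (k - 1 : ℤ) (k - 1 : ℤ))⁻¹ := by
    have h := hC k k (by omega)
    have h3 := face (k - 1) k (by omega) (by omega) (by omega)
    rw [Nat.cast_sub h1, Nat.cast_one] at h3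
    rw [lower k h1 h2, mul_one, h3] at h
    rw [← h]; group
  -- Two applications of x ↦ ux⁻¹, one full twist, amount to conjugation by `u`.
  have diag (k : ℕ) (hk : k ≤ n) : P (2 * k : ℤ) (2 * k : ℤ) = u ^ k * a * (u ^ k)⁻¹ := by
    induction k with
    | zero => simpa using diag0
    | succ k ih =>
      have e1 := step (2 * k + 1) (by omega) (by omega)
      have e2 := step (2 * k + 2) (by omega) (by omega)
      push_cast at e1 e2 ⊢
      rw [show (2 * (k : ℤ) + 1 - 1) = 2 * k by ring, ih (by omega)] at e1
      rw [show (2 * (k : ℤ) + 2 - 1) = 2 * k + 1 by ring, e1] at e2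
      rw [show 2 * ((k : ℤ) + 1) = 2 * k + 2 by ring, e2]
      group
  set R := u ^ n * a * (u ^ n)⁻¹ with hR
  have hRn : P (2 * n : ℤ) (2 * n : ℤ) = R := diag n le_rfl
  -- Of the two clasp crossings, `c2` determines the label R * a of the face inside the clasp, and
  -- `c1` then becomes the relation.
  have c1 := hC (2 * n + 2) (2 * n + 2) (by omega)
  have c2 := hC (2 * n + 3) (2 * n + 3) (by omega)
  have f1 : P (2 * n + 1) (2 * n + 2) = a := by
    have upper (i : ℕ) : (i : ℤ) ≤ 2 * n + 2 → P (i - 1) (2 * n + 2) = a := by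
      induction i with
      | zero => intro _; simpa using left (2 * n + 2) (by omega)
      | succ i ih =>
        intro hi
        rw [← ih (by omega), hV i _ (by omega)]
        congr 1; push_cast; ring
    have := upper (2 * n + 2) (by omega)
    rw [← this]; congr 1; push_cast; ring
  have f2 : P (2 * n + 2) (2 * n + 3) = a := by
    have upper (i : ℕ) : (i : ℤ) ≤ 2 * n + 3 → P (i - 1) (2 * n + 3) = a := by
      induction i with
      | zero => intro _; simpa using left (2 * n + 3) (by omega)
      | succ i ih =>
        intro hi
        rw [← ih (by omega), hV i _ (by omega)]
        congr 1; push_cast; ring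
    have := upper (2 * n + 3) (by omega)
    rw [← this]; congr 1; push_cast; ring
  have f3 : P (2 * n + 1) (2 * n + 1) = u := by
    have h0 := face (2 * n - 1) (2 * n + 1) (by omega) (by omega) (by omega)
    have e1 := hV (2 * n) (2 * n + 1) (by omega)
    have e2 := hV (2 * n + 1) (2 * n + 1) (by omega)
    rw [← e2, add_sub_cancel_right, ← e1, ← h0]
    congr 1; omega
  have f4 : P (2 * n + 2) (2 * n + 1) = R := by
    have e1 := hV (2 * n + 1) (2 * n) (by omega)
    have e2 := hV (2 * n + 2) (2 * n) (by omega)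
    have e3 := hH (2 * n + 2) (2 * n + 1) (by omega)
    rw [← e3, add_sub_cancel_right, ← e2, show (2 * n + 2 - 1 : ℤ) = 2 * n + 1 by ring, ← e1,
      add_sub_cancel_right, hRn]
  have f5 : P (2 * n + 3) (2 * n + 2) = R := by
    have e1 := hV (2 * n + 3) (2 * n + 1) (by omega)
    have e2 := hH (2 * n + 3) (2 * n + 2) (by omega)
    rw [← e2, show (2 * n + 2 - 1 : ℤ) = 2 * n + 1 by ring, ← e1,
      show (2 * n + 3 - 1 : ℤ) = 2 * n + 2 by ring, f4]
  have f6 : P (2 * n + 3) (2 * n + 3) = 1 := by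
    have e1 := hV (2 * n + 4) (2 * n + 3) (by omega)
    rw [show (2 * n + 4 - 1 : ℤ) = 2 * n + 3 by ring] at e1
    rw [e1]; exact hO _ _ (by omega)
  rw [show (2 * n + 2 - 1 : ℤ) = 2 * n + 1 by ring, f1, f3, f4] at c1
  rw [show (2 * n + 3 - 1 : ℤ) = 2 * n + 2 by ring, f2, f6, f5, mul_one] at c2
  have c3 : P (2 * n + 2) (2 * n + 2) = R * a := by
    rw [← inv_mul_eq_one, ← mul_assoc, ← c2, inv_mul_cancel]
  rw [← c1, c3, mul_assoc]

end TwistKnot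

/-! ### The dihedral labeling, which detects the commutator. -/

namespace TwistKnot

/-- The labeling of the twist knot diagram by the dihedral group of order `2 * (4 * n - 1)`. -/
def dihedralLabel (n : ℕ) (i j : ℤ) : DihedralGroup (4 * n - 1) :=
  if j = 0 then (if -1 ≤ i ∧ i ≤ 0 then .sr 0 else 1)
  else if 1 ≤ j ∧ j ≤ 2 * n - 1 then
    (if i = -1 then .sr 0 else if 0 ≤ i ∧ i < j then .r 1
      else if i = j then .sr (-(j : ZMod (4 * n - 1))) else 1)
  else if j = 2 * n then
    (if i = -1 then .sr 0 else if 0 ≤ i ∧ i < 2 * n then .r 1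
      else if 2 * n ≤ i ∧ i ≤ 2 * n + 3 then .sr (-(2 * n : ZMod (4 * n - 1))) else 1)
  else if j = 2 * n + 1 then
    (if i = -1 then .sr 0 else if 0 ≤ i ∧ i ≤ 2 * n + 1 then .r 1
      else if 2 * n + 2 ≤ i ∧ i ≤ 2 * n + 3 then .sr (-(2 * n : ZMod (4 * n - 1))) else 1)
  else if j = 2 * n + 2 then
    (if -1 ≤ i ∧ i ≤ 2 * n + 1 then .sr 0 else if i = 2 * n + 2 then .r (2 * n)
      else if i = 2 * n + 3 then .sr (-(2 * n : ZMod (4 * n - 1))) else 1)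
  else if j = 2 * n + 3 then (if -1 ≤ i ∧ i ≤ 2 * n + 2 then .sr 0 else 1)
  else 1

section Rows

variable {n : ℕ} (i j : ℤ)

theorem dihedralLabel_zero :
    dihedralLabel n i 0 = if -1 ≤ i ∧ i ≤ 0 then .sr 0 else 1 := by
  unfold dihedralLabel
  rw [if_pos rfl]

theorem dihedralLabel_of_le (h₁ : 1 ≤ j) (h₂ : j ≤ 2 * n - 1) : dihedralLabel n i j =
    if i = -1 then .sr 0 else if 0 ≤ i ∧ i < j then .r 1
      else if i = j then .sr (-(j : ZMod (4 * n - 1))) else 1 := by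
  unfold dihedralLabel
  rw [if_neg (by omega), if_pos (by omega)]

theorem dihedralLabel_two_mul (hn : 1 ≤ n) : dihedralLabel n i (2 * n) =
    if i = -1 then .sr 0 else if 0 ≤ i ∧ i < 2 * n then .r 1
      else if 2 * n ≤ i ∧ i ≤ 2 * n + 3 then .sr (-(2 * n : ZMod (4 * n - 1))) else 1 := by
  unfold dihedralLabel
  rw [if_neg (by omega), if_neg (by omega), if_pos rfl]

theorem dihedralLabel_two_mul_add_one : dihedralLabel n i (2 * n + 1) =
    if i = -1 then .sr 0 else if 0 ≤ i ∧ i ≤ 2 * n + 1 then .r 1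
      else if 2 * n + 2 ≤ i ∧ i ≤ 2 * n + 3 then .sr (-(2 * n : ZMod (4 * n - 1))) else 1 := by
  unfold dihedralLabel
  rw [if_neg (by omega), if_neg (by omega), if_neg (by omega), if_pos rfl]

theorem dihedralLabel_two_mul_add_two : dihedralLabel n i (2 * n + 2) =
    if -1 ≤ i ∧ i ≤ 2 * n + 1 then .sr 0 else if i = 2 * n + 2 then .r (2 * n)
      else if i = 2 * n + 3 then .sr (-(2 * n : ZMod (4 * n - 1))) else 1 := by
  unfold dihedralLabel
  rw [if_neg (by omega), if_neg (by omega), if_neg (by omega), if_neg (by omega), if_pos rfl]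

theorem dihedralLabel_two_mul_add_three : dihedralLabel n i (2 * n + 3) =
    if -1 ≤ i ∧ i ≤ 2 * n + 2 then .sr 0 else 1 := by
  unfold dihedralLabel
  rw [if_neg (by omega), if_neg (by omega), if_neg (by omega), if_neg (by omega),
    if_neg (by omega), if_pos rfl]

theorem dihedralLabel_of_outside (h : j < 0 ∨ 2 * n + 4 ≤ j) : dihedralLabel n i j = 1 := by
  unfold dihedralLabel
  rw [if_neg (by omega), if_neg (by omega), if_neg (by omega), if_neg (by omega),
    if_neg (by omega), if_neg (by omega)]

theorem row_cases (n : ℕ) (j : ℤ) : (j < 0 ∨ 2 * n + 4 ≤ j) ∨ j = 0 ∨ (1 ≤ j ∧ j ≤ 2 * n - 1) ∨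
    j = 2 * n ∨ j = 2 * n + 1 ∨ j = 2 * n + 2 ∨ j = 2 * n + 3 := by
  omega

end Rows

theorem dihedralLabel_vert {n : ℕ} (hn : 1 ≤ n) (i j : ℤ) (h : ¬ (twistDiagram n).vert i j) :
    dihedralLabel n (i - 1) j = dihedralLabel n i j := by
  simp only [twistDiagram] at h
  -- In a given row, the label changes only at the columns carrying a vertical edge; `aux` excludes
  -- these one at a time.
  have aux (c : ℤ) (hc : i = c → (twistDiagram n).vert i j) : i ≠ c := fun e => h (hc e)
  simp only [twistDiagram] at aux
  rcases row_cases n j with hj | rfl | hj | rfl | rfl | rfl | rfl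
  · simp only [dihedralLabel_of_outside _ _ hj]
  · have h₁ := aux (-1) (by omega)
    have h₂ := aux 1 (by omega)
    clear h aux
    simp only [dihedralLabel_zero]
    split_ifs <;> first | (exfalso; omega) | rfl
  · have h₁ := aux (-1) (by omega)
    have h₂ := aux 0 (by omega)
    have h₃ := aux j (by omega)
    have h₄ := aux (j + 1) (by omega)
    clear h aux
    simp only [dihedralLabel_of_le _ _ hj.1 hj.2]
    split_ifs <;> first | (exfalso; omega) | rfl
  · have h₁ := aux (-1) (by omega)
    have h₂ := aux 0 (by omega)
    have h₃ := aux (2 * n) (by omega)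
    have h₄ := aux (2 * n + 4) (by omega)
    clear h aux
    simp only [dihedralLabel_two_mul _ hn]
    split_ifs <;> first | (exfalso; omega) | rfl
  · have h₁ := aux (-1) (by omega)
    have h₂ := aux 0 (by omega)
    have h₃ := aux (2 * n + 2) (by omega)
    have h₄ := aux (2 * n + 4) (by omega)
    clear h aux
    simp only [dihedralLabel_two_mul_add_one]
    split_ifs <;> first | (exfalso; omega) | rfl
  · have h₁ := aux (-1) (by omega)
    have h₂ := aux (2 * n + 2) (by omega)
    have h₃ := aux (2 * n + 3) (by omega)
    have h₄ := aux (2 * n + 4) (by omega)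
    clear h aux
    simp only [dihedralLabel_two_mul_add_two]
    split_ifs <;> first | (exfalso; omega) | rfl
  · have h₁ := aux (-1) (by omega)
    have h₂ := aux (2 * n + 3) (by omega)
    clear h aux
    simp only [dihedralLabel_two_mul_add_three]
    split_ifs <;> first | (exfalso; omega) | rfl

theorem dihedralLabel_horiz {n : ℕ} (hn : 1 ≤ n) (i j : ℤ) (h : ¬ (twistDiagram n).horiz i j) :
    dihedralLabel n i (j - 1) = dihedralLabel n i j := by
  simp only [twistDiagram] at h
  have aux (c d : ℤ) (hc : c ≤ i ∧ i ≤ d → (twistDiagram n).horiz i j) : ¬ (c ≤ i ∧ i ≤ d) :=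
    fun e => h (hc e)
  simp only [twistDiagram] at aux
  rcases row_cases n j with hj | rfl | hj | rfl | rfl | rfl | rfl
  · rw [dihedralLabel_of_outside _ _ hj]
    by_cases hj' : j = 2 * n + 4
    · subst hj'
      have h₁ := aux (-1) (2 * n + 2) (by omega)
      rw [show (2 * n + 4 - 1 : ℤ) = 2 * n + 3 by ring, dihedralLabel_two_mul_add_three, if_neg h₁]
    · exact dihedralLabel_of_outside _ _ (by omega)
  · have h₁ := aux (-1) 0 (by omega)
    rw [dihedralLabel_zero, if_neg h₁, dihedralLabel_of_outside _ _ (by omega)]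
  · have h₁ := aux (j - 1) j (by omega)
    clear h aux
    rw [dihedralLabel_of_le _ _ hj.1 hj.2]
    by_cases hj' : j = 1
    · subst hj'
      simp only [sub_self, dihedralLabel_zero]
      split_ifs <;> first | (exfalso; omega) | rfl
    · rw [dihedralLabel_of_le _ _ (by omega) (by omega)]
      split_ifs <;> first | (exfalso; omega) | rfl
  · have h₁ := aux (2 * n - 1) (2 * n + 3) (by omega)
    clear h aux
    rw [dihedralLabel_two_mul _ hn, dihedralLabel_of_le _ _ (by omega) (by omega)]
    split_ifs <;> first | (exfalso; omega) | rfl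
  · have h₁ := aux (2 * n) (2 * n + 1) (by omega)
    clear h aux
    rw [add_sub_cancel_right, dihedralLabel_two_mul_add_one, dihedralLabel_two_mul _ hn]
    split_ifs <;> first | (exfalso; omega) | rfl
  · have h₁ := aux 0 (2 * n + 2) (by omega)
    clear h aux
    rw [show (2 * n + 2 - 1 : ℤ) = 2 * n + 1 by ring, dihedralLabel_two_mul_add_one,
      dihedralLabel_two_mul_add_two]
    split_ifs <;> first | (exfalso; omega) | rfl
  · have h₁ := aux (2 * n + 2) (2 * n + 3) (by omega)
    clear h aux
    rw [show (2 * n + 3 - 1 : ℤ) = 2 * n + 2 by ring, dihedralLabel_two_mul_add_two,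
      dihedralLabel_two_mul_add_three]
    split_ifs <;> first | (exfalso; omega) | rfl

/-- Away from the crossings, the diagram is straight or empty. -/
theorem twistDiagram_crossing {n : ℕ} {i j : ℤ} (h : ¬ (twistDiagram n).post i j)
    (hv : (twistDiagram n).vert i j ∨ (twistDiagram n).vert i (j - 1))
    (hh : (twistDiagram n).horiz i j ∨ (twistDiagram n).horiz (i - 1) j) :
    (i = j ∧ 1 ≤ i ∧ i ≤ 2 * n) ∨ (i = 2 * n + 2 ∧ j = 2 * n + 2) ∨
      (i = 2 * n + 3 ∧ j = 2 * n + 3) := by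
  simp only [twistDiagram] at h hv hh
  push Not at h
  obtain ⟨h₁, h₂, h₃, h₄, h₅, h₆⟩ := h
  -- Apart from the crossings, the non-corner points of vertical edges are interior to the three
  -- connecting columns, which no horizontal edge meets there.
  have key : ((i = j ∧ 1 ≤ i ∧ i ≤ 2 * n) ∨ (i = 2 * n + 2 ∧ j = 2 * n + 2) ∨
      (i = 2 * n + 3 ∧ j = 2 * n + 3)) ∨ (i = 2 * n + 4 ∧ 2 * n + 1 ≤ j ∧ j ≤ 2 * n + 2) ∨
      (i = 0 ∧ 2 ≤ j ∧ j ≤ 2 * n + 1) ∨ (i = -1 ∧ 1 ≤ j ∧ j ≤ 2 * n + 3) := by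
    rcases hv with (hv | hv | hv | hv | hv | hv) | (hv | hv | hv | hv | hv | hv)
    · have := h₁ hv.1 hv.2.1; clear h₁ h₂ h₃ h₄ h₅ h₆ hh; exact .inl (.inl (by omega))
    · have := h₂ hv.1; clear h₁ h₂ h₃ h₄ h₅ h₆ hh; exact .inl (.inr (.inl (by omega)))
    · have := h₃ hv.1; clear h₁ h₂ h₃ h₄ h₅ h₆ hh; exact .inl (.inr (.inr (by omega)))
    · have := h₄ hv.1; clear h₁ h₂ h₃ h₄ h₅ h₆ hh; exact .inr (.inl (by omega))
    · have := h₅ hv.1; clear h₁ h₂ h₃ h₄ h₅ h₆ hh; exact .inr (.inr (.inl (by omega)))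
    · have := h₆ hv.1; clear h₁ h₂ h₃ h₄ h₅ h₆ hh; exact .inr (.inr (.inr (by omega)))
    · have := h₁ hv.1 hv.2.1; clear h₁ h₂ h₃ h₄ h₅ h₆ hh; exact .inl (.inl (by omega))
    · have := h₂ hv.1; clear h₁ h₂ h₃ h₄ h₅ h₆ hh; exact .inl (.inr (.inl (by omega)))
    · have := h₃ hv.1; clear h₁ h₂ h₃ h₄ h₅ h₆ hh; exact .inl (.inr (.inr (by omega)))
    · have := h₄ hv.1; clear h₁ h₂ h₃ h₄ h₅ h₆ hh; exact .inr (.inl (by omega))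
    · have := h₅ hv.1; clear h₁ h₂ h₃ h₄ h₅ h₆ hh; exact .inr (.inr (.inl (by omega)))
    · have := h₆ hv.1; clear h₁ h₂ h₃ h₄ h₅ h₆ hh; exact .inr (.inr (.inr (by omega)))
  clear hv h₁ h₂ h₃ h₄ h₅ h₆
  refine key.resolve_right fun key => ?_
  rcases key with key | key | key <;>
    rcases hh with (hh | hh | hh | hh | hh | hh | hh) | (hh | hh | hh | hh | hh | hh | hh) <;> omega

theorem isFaceLabeling_dihedralLabel {n : ℕ} (hn : 1 ≤ n) :
    (twistDiagram n).IsFaceLabeling (dihedralLabel n) := by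
  -- The modulus is dictated by the clasp crossing at `2 * n + 2`, the only crossing whose relation
  -- uses it.
  have hm : (4 * n : ZMod (4 * n - 1)) = 1 := by
    have := ZMod.natCast_self (4 * n - 1)
    rw [Nat.cast_sub (by omega)] at this
    push_cast at this
    exact sub_eq_zero.1 this
  refine ⟨dihedralLabel_vert hn, dihedralLabel_horiz hn, fun i j h => ?_, fun i j h => ?_⟩
  -- Unless a vertical and a horizontal edge meet at the point, the crossing relation follows from
  -- equality of adjacent labels.
  · by_cases h1 : ¬ (twistDiagram n).vert i j ∧ ¬ (twistDiagram n).vert i (j - 1)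
    · rw [dihedralLabel_vert hn _ _ h1.1, dihedralLabel_vert hn _ _ h1.2]; simp
    by_cases h2 : ¬ (twistDiagram n).horiz i j ∧ ¬ (twistDiagram n).horiz (i - 1) j
    · rw [dihedralLabel_horiz hn _ _ h2.1, dihedralLabel_horiz hn _ _ h2.2]
    obtain ⟨rfl, h3, h4⟩ | ⟨rfl, rfl⟩ | ⟨rfl, rfl⟩ :=
      twistDiagram_crossing h (or_iff_not_and_not.2 h1) (or_iff_not_and_not.2 h2)
    · have diag (k : ℤ) (hk : 0 ≤ k) (hk' : k ≤ 2 * n) :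
          dihedralLabel n k k = .sr (-(k : ZMod (4 * n - 1))) := by
        rcases (by omega : k = 0 ∨ (1 ≤ k ∧ k ≤ 2 * n - 1) ∨ k = 2 * n) with rfl | hk'' | rfl
        · simp [dihedralLabel_zero]
        · rw [dihedralLabel_of_le _ _ hk''.1 hk''.2, if_neg (by omega), if_neg (by omega),
            if_pos rfl]
        · rw [dihedralLabel_two_mul _ hn, if_neg (by omega), if_neg (by omega),
            if_pos (by omega)]
          push_cast; rfl
      have above : dihedralLabel n (i - 1) i = .r 1 := by
        rcases (by omega : i ≤ 2 * n - 1 ∨ i = 2 * n) with h5 | rfl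
        · rw [dihedralLabel_of_le _ _ h3 h5, if_neg (by omega), if_pos (by omega)]
        · rw [dihedralLabel_two_mul _ hn, if_neg (by omega), if_pos (by omega)]
      have below : dihedralLabel n i (i - 1) = 1 := by
        rcases (by omega : i = 1 ∨ 2 ≤ i) with rfl | h5
        · simp [dihedralLabel_zero]
        · rw [dihedralLabel_of_le _ _ (by omega) (by omega), if_neg (by omega),
            if_neg (by omega), if_neg (by omega)]
      rw [diag i (by omega) h4, diag (i - 1) (by omega) (by omega), above, below]
      simp
      ring
    · rw [show (2 * n + 2 - 1 : ℤ) = 2 * n + 1 by ring, dihedralLabel_two_mul_add_two,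
        dihedralLabel_two_mul_add_two, dihedralLabel_two_mul_add_one,
        dihedralLabel_two_mul_add_one, if_pos (by omega), if_neg (by omega), if_pos rfl,
        if_neg (by omega), if_pos (by omega), if_neg (by omega), if_neg (by omega),
        if_pos (by omega)]
      simp
      linear_combination hm
    · rw [show (2 * n + 3 - 1 : ℤ) = 2 * n + 2 by ring, dihedralLabel_two_mul_add_two,
        dihedralLabel_two_mul_add_two, dihedralLabel_two_mul_add_three,
        dihedralLabel_two_mul_add_three, if_pos (by omega), if_neg (by omega),
        if_neg (by omega), if_pos rfl, if_neg (by omega), if_neg (by omega), if_pos rfl]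
      simp
  · simp only [twistDiagram] at h
    rcases row_cases n j with hj | rfl | hj | rfl | rfl | rfl | rfl
    · exact dihedralLabel_of_outside _ _ hj
    · rw [dihedralLabel_zero, if_neg (by omega)]
    · rw [dihedralLabel_of_le _ _ hj.1 hj.2, if_neg (by omega), if_neg (by omega),
        if_neg (by omega)]
    · rw [dihedralLabel_two_mul _ hn, if_neg (by omega), if_neg (by omega), if_neg (by omega)]
    · rw [dihedralLabel_two_mul_add_one, if_neg (by omega), if_neg (by omega), if_neg (by omega)]
    · rw [dihedralLabel_two_mul_add_two, if_neg (by omega), if_neg (by omega), if_neg (by omega)]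
    · rw [dihedralLabel_two_mul_add_three, if_neg (by omega)]

theorem dihedralLabel_commutator_ne_one {n : ℕ} (hn : 1 ≤ n) :
    (dihedralLabel n (-1) 0)⁻¹ * dihedralLabel n 0 1 * dihedralLabel n (-1) 0 *
      (dihedralLabel n 0 1)⁻¹ ≠ 1 := by
  rw [dihedralLabel_zero, dihedralLabel_of_le _ _ (by omega) (by omega), if_pos (by omega),
    if_neg (by omega), if_pos (by omega)]
  -- The commutator is the rotation by -2, and 4n - 1 ≥ 3 does not divide 2.
  have h2 : (2 : ZMod (4 * n - 1)) ≠ 0 := by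
    have := (ZMod.natCast_eq_zero_iff 2 (4 * n - 1)).not.2
      (fun h => by have := Nat.le_of_dvd (by norm_num) h; omega)
    exact_mod_cast this
  intro h
  apply h2
  rw [DihedralGroup.one_def] at h
  simp only [DihedralGroup.inv_sr, DihedralGroup.sr_mul_r, DihedralGroup.sr_mul_sr,
    DihedralGroup.inv_r, DihedralGroup.r_mul_r, DihedralGroup.r.injEq] at h
  linear_combination -h

end TwistKnot

/-! ### Monodromy of a covering space given by gluing data. -/

namespace TwistKnot

open Topology

section Monodromy

variable {ι X F : Type*} [TopologicalSpace X]

/-- The gluing data of a covering space that is trivial over each set of an open cover: in terms of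
a discontinuous global trivialization, the local trivialization over `U i` is given by `g i`. -/
structure GluingData (ι X F : Type*) [TopologicalSpace X] where
  U : ι → Set X
  isOpen_U : ∀ i, IsOpen (U i)
  exists_mem_U : ∀ x, ∃ i, x ∈ U i
  g : ι → X → Equiv.Perm F
  locallyConst : ∀ i j, ∀ x ∈ U i ∩ U j,
    ∀ᶠ y in 𝓝 x, g j y * (g i y)⁻¹ = g j x * (g i x)⁻¹

namespace GluingData

variable (D : GluingData ι X F)

/-- The covering space, as a fiber bundle with discrete fiber. -/
noncomputable def core [TopologicalSpace F] [DiscreteTopology F] : FiberBundleCore ι X F where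
  baseSet := D.U
  isOpen_baseSet := D.isOpen_U
  indexAt x := (D.exists_mem_U x).choose
  mem_baseSet_at x := (D.exists_mem_U x).choose_spec
  coordChange i j x v := (D.g j x * (D.g i x)⁻¹) v
  coordChange_self i x _ v := by simp
  continuousOn_coordChange i j := by
    rintro ⟨x, v⟩ ⟨hx, -⟩
    refine ContinuousAt.continuousWithinAt ?_
    have h : ∀ᶠ p : X × F in 𝓝 (x, v),
        (D.g j p.1 * (D.g i p.1)⁻¹) p.2 = (D.g j x * (D.g i x)⁻¹) v := by
      have h1 := (continuous_fst.tendsto (x, v)).eventually (D.locallyConst i j x hx)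
      have h2 : ∀ᶠ p : X × F in 𝓝 (x, v), p.2 = v :=
        (continuous_snd.tendsto (x, v)).eventually
          (p := fun w => w = v) (by simp [nhds_discrete])
      filter_upwards [h1, h2] with p hp1 hp2
      rw [hp1, hp2]
    exact tendsto_const_nhds.congr' (h.mono fun p hp => hp.symm)
  coordChange_comp i j k x _ v := by simp

/-- A covering space given by gluing data has a monodromy, which is trivial over each of the sets
of the cover. -/
theorem exists_monodromy (D : GluingData ι X F) :
    ∃ M : ∀ {x y : X}, Path.Homotopic.Quotient x y → Equiv.Perm F,
      (∀ {x y z : X} (γ : Path.Homotopic.Quotient x y) (γ' : Path.Homotopic.Quotient y z),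
        M (γ.trans γ') = M γ' * M γ) ∧
      ∀ i {x y : X} (γ : Path x y), (∀ t, γ t ∈ D.U i) →
        M (.mk γ) = (D.g i y)⁻¹ * D.g i x := by
  let _ : TopologicalSpace F := ⊥
  have : DiscreteTopology F := ⟨rfl⟩
  let Z := D.core
  have cov : IsCoveringMap Z.proj := FiberBundle.isCoveringMap (F := F) (E := Z.Fiber)
  -- The global identification of the fibers with `F`: total space points are recorded in the
  -- preferred chart at `x`, and its gauge factor is undone. Seen in any chart `i` around `x`, `e x`
  -- is `g i x`.
  let e (x : X) : F ≃ Z.proj ⁻¹' {x} :=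
    { toFun := fun v => ⟨⟨x, D.g (Z.indexAt x) x v⟩, rfl⟩
      invFun := fun p => (D.g (Z.indexAt x) x)⁻¹ (by
        obtain ⟨⟨x', v⟩, h⟩ := p; exact v)
      left_inv := fun v => by simp
      right_inv := by
        rintro ⟨⟨x', v⟩, h⟩
        obtain rfl : x' = x := h
        exact Subtype.ext (congrArg (Bundle.TotalSpace.mk x')
          ((D.g (Z.indexAt x') x').apply_symm_apply v)) }
  refine ⟨fun {x y} γ => (e x).trans ((Equiv.ofBijective _ (cov.monodromy_bijective γ)).trans
    (e y).symm), ?_, ?_⟩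
  · intro x y z γ γ'
    ext v
    simp [cov.monodromy_trans_apply]
  · intro i x y γ hγ
    ext v
    simp only [Equiv.trans_apply, Equiv.symm_apply_eq]
    let w := D.g i x v
    -- The lift of `γ` whose coordinate in chart `i` is constantly `w`.
    let Γ : Path ((e x v : Z.TotalSpace)) (e y (((D.g i y)⁻¹ * D.g i x) v) : Z.TotalSpace) :=
      { toFun := fun t => ⟨γ t, Z.coordChange i (Z.indexAt (γ t)) (γ t) w⟩
        continuous_toFun := by
          refine (Z.localTriv i).toOpenPartialHomeomorph.continuousOn_symm.comp_continuous
            (f := fun t => (γ t, w)) (by fun_prop) fun t => ?_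
          exact (Z.mem_localTriv_target i _).2 (hγ t)
        source' := by
          rw [γ.source]
          exact congrArg (Bundle.TotalSpace.mk x) (by simp [w, Z, core]; rfl)
        target' := by
          rw [γ.target]
          exact congrArg (Bundle.TotalSpace.mk y) (by simp [w, Z, core]; rfl) }
    exact cov.monodromy_eq_of_map_eq (γ := .mk γ) (.mk Γ) rfl

end GluingData

end Monodromy

end TwistKnot

/-! ### Elements of the fundamental group given by segments. -/

namespace TwistKnot

open Path

section EdgeElements

variable {W X : Type*} [AddCommGroup W] [Module ℝ W] [TopologicalSpace W]
  [IsTopologicalAddGroup W] [ContinuousSMul ℝ W] [TopologicalSpace X] {S : Set W}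

/-- The straight path between two points, in a set that contains the segment between them. -/
noncomputable def segmentPath {a b : W} (h : segment ℝ a b ⊆ S) :
    Path (⟨a, h (left_mem_segment ℝ a b)⟩ : S) ⟨b, h (right_mem_segment ℝ a b)⟩ where
  toFun t := ⟨AffineMap.lineMap a b (t : ℝ), h (by
    rw [segment_eq_image_lineMap]; exact Set.mem_image_of_mem _ t.2)⟩
  continuous_toFun := by
    refine Continuous.subtype_mk ?_ _
    simp only [AffineMap.lineMap_apply_module]
    fun_prop
  source' := by simp
  target' := by simp

theorem segmentPath_mem_segment {a b : W} (h : segment ℝ a b ⊆ S) (t : unitInterval) :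
    (segmentPath h t : W) ∈ segment ℝ a b := by
  rw [segment_eq_image_lineMap]; exact Set.mem_image_of_mem _ t.2

/-- Two paths with the same ends in a convex set are homotopic. -/
theorem mk_eq_mk_of_convex {C : Set W} (hC : Convex ℝ C) (hCS : C ⊆ S) {a b : S} (p q : Path a b)
    (hp : ∀ t, (p t : W) ∈ C) (hq : ∀ t, (q t : W) ∈ C) : Homotopic.Quotient.mk p = Homotopic.Quotient.mk q := by
  have ha : (a : W) ∈ C := by simpa using hp 0
  have hb : (b : W) ∈ C := by simpa using hp 1
  have : ContractibleSpace C := hC.contractibleSpace ⟨a, ha⟩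
  let i : C(C, S) := ⟨Set.inclusion hCS, continuous_inclusion hCS⟩
  let p' : Path (⟨a, ha⟩ : C) ⟨b, hb⟩ :=
    { toFun := fun t => ⟨p t, hp t⟩
      continuous_toFun := by fun_prop
      source' := by simp
      target' := by simp }
  let q' : Path (⟨a, ha⟩ : C) ⟨b, hb⟩ :=
    { toFun := fun t => ⟨q t, hq t⟩
      continuous_toFun := by fun_prop
      source' := by simp
      target' := by simp }
  have h := (SimplyConnectedSpace.paths_homotopic p' q').map i
  exact Homotopic.Quotient.eq.2 h

theorem mk_segmentPath_trans {C : Set W} (hC : Convex ℝ C) (hCS : C ⊆ S) {a b c : W}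
    (ha : a ∈ C) (hb : b ∈ C) (hc : c ∈ C) (hab : segment ℝ a b ⊆ S) (hbc : segment ℝ b c ⊆ S)
    (hac : segment ℝ a c ⊆ S) :
    (Homotopic.Quotient.mk (segmentPath hab)).trans (Homotopic.Quotient.mk (segmentPath hbc)) = Homotopic.Quotient.mk (segmentPath hac) := by
  rw [← Homotopic.Quotient.mk_trans]
  refine mk_eq_mk_of_convex hC hCS _ _ (fun t => ?_) fun t =>
    hC.segment_subset ha hc (segmentPath_mem_segment hac t)
  rw [Path.trans_apply]
  split_ifs
  · exact hC.segment_subset ha hb (segmentPath_mem_segment hab _)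
  · exact hC.segment_subset hb hc (segmentPath_mem_segment hbc _)

variable [PathConnectedSpace X] (f : C(S, X)) (x₀ : X)

/-- The class of a chosen path from the base point. -/
noncomputable def baseClass (x : X) : Path.Homotopic.Quotient x₀ x :=
  .mk (PathConnectedSpace.somePath x₀ x)

open Classical in
/-- The element of the fundamental group given by the image of a segment, closed up by chosen paths
to the base point. -/
noncomputable def edgeElement (a b : W) : FundamentalGroup X x₀ :=
  if h : segment ℝ b a ⊆ S then
    ((baseClass x₀ (f ⟨b, h (left_mem_segment ℝ b a)⟩)).trans
      ((Homotopic.Quotient.mk (segmentPath h)).map f)).trans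
      (baseClass x₀ (f ⟨a, h (right_mem_segment ℝ b a)⟩)).symm
  else 1

/-- The triangle on the three points bounds inside `C`, and the chosen paths to the middle point
cancel. Edges are traversed from second to first argument because the product in `FundamentalGroup`
concatenates in reverse order. -/
theorem edgeElement_mul {C : Set W} (hC : Convex ℝ C) (hCS : C ⊆ S) {a b c : W}
    (ha : a ∈ C) (hb : b ∈ C) (hc : c ∈ C) :
    edgeElement f x₀ a b * edgeElement f x₀ b c = edgeElement f x₀ a c := by
  have hba := (hC.segment_subset hb ha).trans hCS
  have hcb := (hC.segment_subset hc hb).trans hCS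
  have hca := (hC.segment_subset hc ha).trans hCS
  have key := congrArg (fun q => Homotopic.Quotient.map q f)
    (mk_segmentPath_trans hC hCS hc hb ha hcb hba hca)
  rw [edgeElement, edgeElement, edgeElement, dif_pos hba, dif_pos hcb, dif_pos hca,
    FundamentalGroup.mul_def, ← key]
  generalize Homotopic.Quotient.mk (segmentPath hba) = p
  generalize Homotopic.Quotient.mk (segmentPath hcb) = q
  have hmap : Homotopic.Quotient.map (q.trans p) f = (q.map f).trans (p.map f) :=
    (FundamentalGroupoid.map f).map_comp (X := ⟨_⟩) (Y := ⟨_⟩) (Z := ⟨_⟩) q p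
  simp only [hmap, Homotopic.Quotient.trans_assoc]
  congr 2
  rw [← Homotopic.Quotient.trans_assoc, Homotopic.Quotient.symm_trans, Homotopic.Quotient.refl_trans]

/-- The factor `m a` is the monodromy along the chosen path to the image of `a`; these factors
telescope along a chain of edges, so only the gauge changes remain. -/
theorem GluingData.exists_hom {ι F : Type*} (D : GluingData ι X F) :
    ∃ (Φ : FundamentalGroup X x₀ →* Equiv.Perm F) (m : W → Equiv.Perm F),
      ∀ i (a b : W) (h : segment ℝ a b ⊆ S), (∀ p hp, f ⟨p, h hp⟩ ∈ D.U i) →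
        Φ (edgeElement f x₀ a b) = (m a)⁻¹ * (D.g i (f ⟨a, h (left_mem_segment ℝ a b)⟩))⁻¹ *
          D.g i (f ⟨b, h (right_mem_segment ℝ a b)⟩) * m b := by
  classical
  obtain ⟨M, hM, hMU⟩ := D.exists_monodromy
  have hrefl (x : X) : M (Homotopic.Quotient.refl x) = 1 := by
    have h := hM (Homotopic.Quotient.refl x) (Homotopic.Quotient.refl x)
    rw [Homotopic.Quotient.trans_refl] at h
    exact (mul_eq_left.1 h.symm)
  have hsymm {x y : X} (γ : Path.Homotopic.Quotient x y) : M γ.symm = (M γ)⁻¹ := by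
    rw [eq_inv_iff_mul_eq_one, ← hM, Homotopic.Quotient.trans_symm, hrefl]
  -- Monodromy and the group product both reverse concatenation, so no inverse is needed.
  refine ⟨⟨⟨fun γ => M γ, hrefl x₀⟩, fun γ γ' => hM γ' γ⟩,
    fun a => if h : a ∈ S then M (baseClass x₀ (f ⟨a, h⟩)) else 1, fun i a b h hU => ?_⟩
  have h' : segment ℝ b a ⊆ S := by rwa [segment_symm]
  have hpath : M ((Homotopic.Quotient.mk (segmentPath h')).map f) =
      (D.g i (f ⟨a, h (left_mem_segment ℝ a b)⟩))⁻¹ *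
        D.g i (f ⟨b, h (right_mem_segment ℝ a b)⟩) := by
    rw [← Homotopic.Quotient.mk_map]
    refine hMU i _ fun t => ?_
    have := segmentPath_mem_segment h' t
    rw [segment_symm] at this
    exact hU _ this
  beta_reduce
  rw [dif_pos (h (left_mem_segment ℝ a b)), dif_pos (h (right_mem_segment ℝ a b)), edgeElement,
    dif_pos h']
  change M _ = _
  rw [hM, hM, hsymm, hpath]
  simp only [mul_assoc]

end EdgeElements

end TwistKnot

/-! ### Loops through the faces satisfy the relations of a labeling. -/

namespace TwistKnot

namespace GridDiagram

variable (D : GridDiagram)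

/-- The link in 3-space that has a given grid diagram. -/
def carrier : Set (ℝ × ℝ × ℝ) :=
  {p | (p.2.2 = 1 ∧ ∃ i j : ℤ, D.vert i j ∧ p.1 = i ∧ (j : ℝ) ≤ p.2.1 ∧ p.2.1 ≤ j + 1) ∨
    (p.2.2 = 0 ∧ ∃ i j : ℤ, D.horiz i j ∧ p.2.1 = j ∧ (i : ℝ) ≤ p.1 ∧ p.1 ≤ i + 1) ∨
    ((0 ≤ p.2.2 ∧ p.2.2 ≤ 1) ∧ ∃ i j : ℤ, D.post i j ∧ p.1 = i ∧ p.2.1 = j)}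

theorem mem_bounds_of_mem_carrier {p : ℝ × ℝ × ℝ} (hp : p ∈ D.carrier) :
    (-(D.bound : ℝ) ≤ p.1 ∧ p.1 ≤ D.bound) ∧ (-(D.bound : ℝ) ≤ p.2.1 ∧ p.2.1 ≤ D.bound) ∧
      0 ≤ p.2.2 ∧ p.2.2 ≤ 1 := by
  obtain ⟨x, y, z⟩ := p
  rcases hp with ⟨h, i, j, hv, hx, hy₁, hy₂⟩ | ⟨h, i, j, hv, hy, hx₁, hx₂⟩ | ⟨h, i, j, hv, hx, hy⟩
  · obtain ⟨⟨h₁, h₂⟩, h₃, h₄⟩ := D.vert_bound i j hv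
    rify at h₁ h₂ h₃ h₄
    dsimp only at *
    refine ⟨⟨?_, ?_⟩, ⟨?_, ?_⟩, ?_, ?_⟩ <;> linarith
  · obtain ⟨⟨h₁, h₂⟩, h₃, h₄⟩ := D.horiz_bound i j hv
    rify at h₁ h₂ h₃ h₄
    dsimp only at *
    refine ⟨⟨?_, ?_⟩, ⟨?_, ?_⟩, ?_, ?_⟩ <;> linarith
  · obtain ⟨⟨h₁, h₂⟩, h₃, h₄⟩ := D.post_bound i j hv
    rify at h₁ h₂ h₃ h₄
    dsimp only at *
    refine ⟨⟨?_, ?_⟩, ⟨?_, ?_⟩, ?_, ?_⟩ <;> linarith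

/-- The point at height `z` over the center of a cell. -/
noncomputable def cellPoint (i j : ℤ) (z : ℝ) : ℝ × ℝ × ℝ := (i + 1 / 2, j + 1 / 2, z)

theorem int_eq_of_mem {k i : ℤ} {x : ℝ} (hx : x = k) (h₁ : (i : ℝ) - 1 / 2 ≤ x)
    (h₂ : x ≤ i + 1 / 2) : k = i := by
  have h₃ : (k : ℝ) < i + 1 := by linarith
  have h₄ : (i : ℝ) < k + 1 := by linarith
  norm_cast at h₃ h₄
  omega

theorem int_eq_of_half {k i : ℤ} {x : ℝ} (hx : x = i + 1 / 2) (h₁ : (k : ℝ) ≤ x)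
    (h₂ : x ≤ k + 1) : k = i := by
  have h₃ : (k : ℝ) < i + 1 := by linarith
  have h₄ : (i : ℝ) < k + 1 := by linarith
  norm_cast at h₃ h₄
  omega

theorem half_ne_int {k i : ℤ} {x : ℝ} (hx : x = i + 1 / 2) (h : x = k) : False := by
  have h₁ := int_eq_of_half (k := k) hx h.ge (by linarith)
  subst h₁
  linarith

section FreeSets

variable (i j : ℤ)

theorem upper_free : {p : ℝ × ℝ × ℝ | 1 < p.2.2} ⊆ D.carrierᶜ :=
  fun _ hp h => (D.mem_bounds_of_mem_carrier h).2.2.2.not_gt hp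

theorem lower_free : {p : ℝ × ℝ × ℝ | p.2.2 < 0} ⊆ D.carrierᶜ :=
  fun _ hp h => (D.mem_bounds_of_mem_carrier h).2.2.1.not_gt hp

theorem left_free : {p : ℝ × ℝ × ℝ | p.1 < -D.bound} ⊆ D.carrierᶜ :=
  fun _ hp h => (D.mem_bounds_of_mem_carrier h).1.1.not_gt hp

theorem right_free : {p : ℝ × ℝ × ℝ | D.bound < p.1} ⊆ D.carrierᶜ :=
  fun _ hp h => (D.mem_bounds_of_mem_carrier h).1.2.not_gt hp

theorem front_free : {p : ℝ × ℝ × ℝ | p.2.1 < -D.bound} ⊆ D.carrierᶜ :=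
  fun _ hp h => (D.mem_bounds_of_mem_carrier h).2.1.1.not_gt hp

theorem back_free : {p : ℝ × ℝ × ℝ | D.bound < p.2.1} ⊆ D.carrierᶜ :=
  fun _ hp h => (D.mem_bounds_of_mem_carrier h).2.1.2.not_gt hp

/-- The box with given sides. -/
abbrev box (x₁ x₂ y₁ y₂ z₁ z₂ : ℝ) : Set (ℝ × ℝ × ℝ) :=
  Set.Icc x₁ x₂ ×ˢ Set.Icc y₁ y₂ ×ˢ Set.Icc z₁ z₂

theorem convex_box (x₁ x₂ y₁ y₂ z₁ z₂ : ℝ) : Convex ℝ (box x₁ x₂ y₁ y₂ z₁ z₂) :=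
  (convex_Icc _ _).prod ((convex_Icc _ _).prod (convex_Icc _ _))

theorem row_free (h : ¬ D.vert i j) :
    box (i - 1 / 2) (i + 1 / 2) (j + 1 / 2) (j + 1 / 2) (-1) 2 ⊆ D.carrierᶜ := by
  rintro ⟨x, y, z⟩ ⟨⟨hx₁, hx₂⟩, ⟨hy₁, hy₂⟩, -⟩ hp
  have hy := le_antisymm hy₂ hy₁
  rcases hp with ⟨-, i', j', hv, hx', hy₁', hy₂'⟩ | ⟨-, i', j', hv, hy', -, -⟩ |
    ⟨-, i', j', hv, -, hy'⟩
  · rw [int_eq_of_mem hx' hx₁ hx₂, int_eq_of_half hy hy₁' hy₂'] at hv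
    exact h hv
  · exact half_ne_int hy hy'
  · exact half_ne_int hy hy'

theorem col_free (h : ¬ D.horiz i j) :
    box (i + 1 / 2) (i + 1 / 2) (j - 1 / 2) (j + 1 / 2) (-1) 2 ⊆ D.carrierᶜ := by
  rintro ⟨x, y, z⟩ ⟨⟨hx₁, hx₂⟩, ⟨hy₁, hy₂⟩, -⟩ hp
  have hx := le_antisymm hx₂ hx₁
  rcases hp with ⟨-, i', j', hv, hx', -, -⟩ | ⟨-, i', j', hv, hy', hx₁', hx₂'⟩ |
    ⟨-, i', j', hv, hx', -⟩
  · exact half_ne_int hx hx'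
  · rw [int_eq_of_mem hy' hy₁ hy₂, int_eq_of_half hx hx₁' hx₂'] at hv
    exact h hv
  · exact half_ne_int hx hx'

theorem line_free :
    box (i + 1 / 2) (i + 1 / 2) (j + 1 / 2) (j + 1 / 2) (-1) 2 ⊆ D.carrierᶜ := by
  rintro ⟨x, y, z⟩ ⟨⟨hx₁, hx₂⟩, ⟨hy₁, hy₂⟩, -⟩ hp
  have hx := le_antisymm hx₂ hx₁
  have hy := le_antisymm hy₂ hy₁
  rcases hp with ⟨-, i', j', hv, hx', -, -⟩ | ⟨-, i', j', hv, hy', -, -⟩ |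
    ⟨-, i', j', hv, hx', -⟩
  · exact half_ne_int hx hx'
  · exact half_ne_int hy hy'
  · exact half_ne_int hx hx'

theorem row_below_free :
    box (i - 1 / 2) (i + 1 / 2) (j + 1 / 2) (j + 1 / 2) (-1) (1 / 2) ⊆ D.carrierᶜ := by
  rintro ⟨x, y, z⟩ ⟨-, ⟨hy₁, hy₂⟩, hz₁, hz₂⟩ hp
  have hy := le_antisymm hy₂ hy₁
  rcases hp with ⟨hz, -⟩ | ⟨-, i', j', hv, hy', -, -⟩ | ⟨-, i', j', hv, -, hy'⟩
  · dsimp only at hz hz₂; linarith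
  · exact half_ne_int hy hy'
  · exact half_ne_int hy hy'

theorem col_above_free :
    box (i + 1 / 2) (i + 1 / 2) (j - 1 / 2) (j + 1 / 2) (1 / 2) 2 ⊆ D.carrierᶜ := by
  rintro ⟨x, y, z⟩ ⟨⟨hx₁, hx₂⟩, -, hz₁, hz₂⟩ hp
  have hx := le_antisymm hx₂ hx₁
  rcases hp with ⟨-, i', j', hv, hx', -, -⟩ | ⟨hz, -⟩ | ⟨-, i', j', hv, hx', -⟩
  · exact half_ne_int hx hx'
  · dsimp only at hz hz₁; linarith
  · exact half_ne_int hx hx'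

/-- At height 1/2 the link consists of its corner segments only; this is the gap between the strands
of a crossing. -/
theorem square_free (h : ¬ D.post i j) :
    box (i - 1 / 2) (i + 1 / 2) (j - 1 / 2) (j + 1 / 2) (1 / 2) (1 / 2) ⊆ D.carrierᶜ := by
  rintro ⟨x, y, z⟩ ⟨⟨hx₁, hx₂⟩, ⟨hy₁, hy₂⟩, hz₁, hz₂⟩ hp
  dsimp only at hz₁ hz₂
  rcases hp with ⟨hz, -⟩ | ⟨hz, -⟩ | ⟨-, i', j', hv, hx', hy'⟩
  · dsimp only at hz; linarith
  · dsimp only at hz; linarith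
  · rw [int_eq_of_mem hx' hx₁ hx₂, int_eq_of_mem hy' hy₁ hy₂] at hv
    exact h hv

end FreeSets

section Cells

theorem reassoc {G : Type*} [Group G] {a b c d : G} (h : a * b = c * d) (x : G) :
    a * (b * x) = c * (d * x) := by
  rw [← mul_assoc, h, mul_assoc]

variable {G : Type*} [Group G] (e : ℝ × ℝ × ℝ → ℝ × ℝ × ℝ → G)

/-- The loop that passes down through the outer face and up through the given cell. -/
noncomputable def cellElement (i j : ℤ) : G :=
  e (cellPoint (-D.bound - 1) (-D.bound - 1) 2) (cellPoint (-D.bound - 1) (-D.bound - 1) (-1)) *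
    e (cellPoint (-D.bound - 1) (-D.bound - 1) (-1)) (cellPoint i j (-1)) *
    e (cellPoint i j (-1)) (cellPoint i j 2) *
    e (cellPoint i j 2) (cellPoint (-D.bound - 1) (-D.bound - 1) 2)

/-- Each relation is a chain of moves through convex sets off the link. Edges missing from the
diagram let the whole vertical line of a cell move to its neighbor; the crossing relation slides the
meridian of the upper strand over the lower one. -/
theorem isFaceLabeling_cellElement
    (he : ∀ C : Set (ℝ × ℝ × ℝ), Convex ℝ C → C ⊆ D.carrierᶜ →
      ∀ a ∈ C, ∀ b ∈ C, ∀ c ∈ C, e a b * e b c = e a c) :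
    D.IsFaceLabeling (D.cellElement e) := by
  have hself {C : Set (ℝ × ℝ × ℝ)} (hC : Convex ℝ C) (hCD : C ⊆ D.carrierᶜ) {a} (ha : a ∈ C) :
      e a a = 1 := mul_eq_left.1 (he C hC hCD a ha a ha a ha)
  have hupper : Convex ℝ {p : ℝ × ℝ × ℝ | 1 < p.2.2} :=
    convex_halfSpace_gt (f := fun p : ℝ × ℝ × ℝ => p.2.2) ⟨by simp, by simp⟩ 1
  have hlower : Convex ℝ {p : ℝ × ℝ × ℝ | p.2.2 < 0} :=
    convex_halfSpace_lt (f := fun p : ℝ × ℝ × ℝ => p.2.2) ⟨by simp, by simp⟩ 0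
  have hup (i j i' j' i'' j'' : ℤ) : e (cellPoint i j 2) (cellPoint i' j' 2) *
      e (cellPoint i' j' 2) (cellPoint i'' j'' 2) = e (cellPoint i j 2) (cellPoint i'' j'' 2) :=
    he _ hupper D.upper_free _ (by norm_num [cellPoint]) _ (by norm_num [cellPoint]) _
      (by norm_num [cellPoint])
  have hlow (i j i' j' i'' j'' : ℤ) : e (cellPoint i j (-1)) (cellPoint i' j' (-1)) *
      e (cellPoint i' j' (-1)) (cellPoint i'' j'' (-1)) =
        e (cellPoint i j (-1)) (cellPoint i'' j'' (-1)) :=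
    he _ hlower D.lower_free _ (by norm_num [cellPoint]) _ (by norm_num [cellPoint]) _
      (by norm_num [cellPoint])
  have hmove {C : Set (ℝ × ℝ × ℝ)} (hC : Convex ℝ C) (hCD : C ⊆ D.carrierᶜ) (i j i' j' : ℤ)
      (h₁ : cellPoint i j 2 ∈ C) (h₂ : cellPoint i j (-1) ∈ C) (h₃ : cellPoint i' j' 2 ∈ C)
      (h₄ : cellPoint i' j' (-1) ∈ C) : D.cellElement e i j = D.cellElement e i' j' := by
    unfold cellElement
    rw [← hlow _ _ i j i' j', ← hup i' j' i j]
    have : e (cellPoint i j (-1)) (cellPoint i j 2) =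
        e (cellPoint i j (-1)) (cellPoint i' j' (-1)) *
          e (cellPoint i' j' (-1)) (cellPoint i' j' 2) *
          e (cellPoint i' j' 2) (cellPoint i j 2) := by
      rw [he C hC hCD _ h₂ _ h₄ _ h₃, he C hC hCD _ h₂ _ h₃ _ h₁]
    rw [this]
    simp only [mul_assoc]
  have hmid (i j : ℤ) {z₁ z₂ z₃ : ℝ} (h₁ : z₁ ∈ Set.Icc (-1) 2) (h₂ : z₂ ∈ Set.Icc (-1) 2)
      (h₃ : z₃ ∈ Set.Icc (-1) 2) : e (cellPoint i j z₁) (cellPoint i j z₂) *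
        e (cellPoint i j z₂) (cellPoint i j z₃) = e (cellPoint i j z₁) (cellPoint i j z₃) :=
    he _ (convex_box ..) (D.line_free i j) _ ⟨by simp [cellPoint], by simp [cellPoint], h₁⟩ _
      ⟨by simp [cellPoint], by simp [cellPoint], h₂⟩ _
      ⟨by simp [cellPoint], by simp [cellPoint], h₃⟩
  have hleft (i j : ℤ) (h : i < -D.bound) : D.cellElement e i j = 1 := by
    have hC : Convex ℝ {p : ℝ × ℝ × ℝ | p.1 < -D.bound} :=
      convex_halfSpace_lt (f := fun p : ℝ × ℝ × ℝ => p.1) ⟨by simp, by simp⟩ _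
    have hmem (j : ℤ) (z : ℝ) {i : ℤ} (h : i < -D.bound) :
        cellPoint i j z ∈ {p : ℝ × ℝ × ℝ | p.1 < -D.bound} := by
      have : (i : ℝ) + 1 ≤ -D.bound := by exact_mod_cast h
      simp only [cellPoint, Set.mem_ofPred_eq]; linarith
    have h' : -D.bound - 1 < -D.bound := by omega
    rw [hmove hC D.left_free i j (-D.bound - 1) (-D.bound - 1) (hmem _ _ h) (hmem _ _ h)
      (hmem _ _ h') (hmem _ _ h')]
    unfold cellElement
    rw [hself hC D.left_free (hmem _ _ h'), hself hC D.left_free (hmem _ _ h'), mul_one, mul_one,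
      hmid _ _ (by norm_num) (by norm_num) (by norm_num), hself hC D.left_free (hmem _ _ h')]
  have hfront (i j : ℤ) (h : j < -D.bound) : D.cellElement e i j = 1 := by
    have hC : Convex ℝ {p : ℝ × ℝ × ℝ | p.2.1 < -D.bound} :=
      convex_halfSpace_lt (f := fun p : ℝ × ℝ × ℝ => p.2.1) ⟨by simp, by simp⟩ _
    have hmem (i : ℤ) (z : ℝ) : cellPoint i j z ∈ {p : ℝ × ℝ × ℝ | p.2.1 < -D.bound} := by
      have : (j : ℝ) + 1 ≤ -D.bound := by exact_mod_cast h
      simp only [cellPoint, Set.mem_ofPred_eq]; linarith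
    rw [hmove hC D.front_free i j (-D.bound - 1) j (hmem _ _) (hmem _ _) (hmem _ _) (hmem _ _)]
    exact hleft _ _ (by omega)
  refine ⟨fun i j h => ?_, fun i j h => ?_, fun i j h => ?_, fun i j h => ?_⟩
  · refine hmove (convex_box ..) (D.row_free i j h) _ _ _ _ ?_ ?_ ?_ ?_ <;>
      refine ⟨⟨?_, ?_⟩, ⟨?_, ?_⟩, ?_, ?_⟩ <;> simp only [cellPoint] <;> push_cast <;> linarith
  · refine hmove (convex_box ..) (D.col_free i j h) _ _ _ _ ?_ ?_ ?_ ?_ <;>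
      refine ⟨⟨?_, ?_⟩, ⟨?_, ?_⟩, ?_, ?_⟩ <;> simp only [cellPoint] <;> push_cast <;> linarith
  -- The second factor is a meridian of the column: down from the top to height 1/2, under the
  -- possible vertical edge at height 1, and up again.
  · have hV (j : ℤ) : D.cellElement e i j = D.cellElement e (i - 1) j *
        (e (cellPoint (-D.bound - 1) (-D.bound - 1) 2) (cellPoint (i - 1) j 2) *
          e (cellPoint (i - 1) j 2) (cellPoint (i - 1) j (1 / 2)) *
          e (cellPoint (i - 1) j (1 / 2)) (cellPoint i j (1 / 2)) *
          e (cellPoint i j (1 / 2)) (cellPoint i j 2) *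
          e (cellPoint i j 2) (cellPoint (-D.bound - 1) (-D.bound - 1) 2)) := by
      have hmem (i' : ℤ) (hi : i' = i ∨ i' = i - 1) (z : ℝ) (hz : z ∈ Set.Icc (-1) (1 / 2)) :
          cellPoint i' j z ∈
            box (i - 1 / 2) (i + 1 / 2) (j + 1 / 2) (j + 1 / 2) (-1) (1 / 2) := by
        rcases hi with rfl | rfl <;> refine ⟨⟨?_, ?_⟩, ⟨?_, ?_⟩, hz⟩ <;>
          simp only [cellPoint] <;> push_cast <;> linarith
      have h₁ := hup (i - 1) j (-D.bound - 1) (-D.bound - 1) (i - 1) j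
      rw [hself hupper D.upper_free (by norm_num [cellPoint])] at h₁
      have h₂ : e (cellPoint (i - 1) j (-1)) (cellPoint (i - 1) j 2) *
          e (cellPoint (i - 1) j 2) (cellPoint (i - 1) j (1 / 2)) *
          e (cellPoint (i - 1) j (1 / 2)) (cellPoint i j (1 / 2)) =
          e (cellPoint (i - 1) j (-1)) (cellPoint i j (-1)) *
            e (cellPoint i j (-1)) (cellPoint i j (1 / 2)) := by
        rw [hmid _ _ (by norm_num) (by norm_num) (by norm_num),
          he _ (convex_box ..) (D.row_below_free i j) _ (hmem _ (.inr rfl) _ (by norm_num)) _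
            (hmem _ (.inr rfl) _ (by norm_num)) _ (hmem _ (.inl rfl) _ (by norm_num)),
          he _ (convex_box ..) (D.row_below_free i j) _ (hmem _ (.inr rfl) _ (by norm_num)) _
            (hmem _ (.inl rfl) _ (by norm_num)) _ (hmem _ (.inl rfl) _ (by norm_num))]
      have h₃ : e (cellPoint i j (-1)) (cellPoint i j (1 / 2)) *
          e (cellPoint i j (1 / 2)) (cellPoint i j 2) =
            e (cellPoint i j (-1)) (cellPoint i j 2) :=
        hmid _ _ (by norm_num) (by norm_num) (by norm_num)
      have h₄ := hlow (-D.bound - 1) (-D.bound - 1) (i - 1) j i j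
      unfold cellElement
      generalize e (cellPoint (i - 1) j 2) (cellPoint (-D.bound - 1) (-D.bound - 1) 2) = x₁ at *
      generalize e (cellPoint (-D.bound - 1) (-D.bound - 1) 2) (cellPoint (i - 1) j 2) = x₂ at *
      rw [← h₄, ← h₃, eq_inv_of_mul_eq_one_left h₁]
      simp only [mul_assoc, inv_mul_cancel_left] at h₂ ⊢
      rw [← reassoc h₂]
      simp only [mul_assoc]
    have hmem (i j' : ℤ) (hj : j' = j ∨ j' = j - 1) (z : ℝ) (hz : z ∈ Set.Icc (1 / 2) 2) :
        cellPoint i j' z ∈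
          box (i + 1 / 2) (i + 1 / 2) (j - 1 / 2) (j + 1 / 2) (1 / 2) 2 := by
      rcases hj with rfl | rfl <;> refine ⟨⟨?_, ?_⟩, ⟨?_, ?_⟩, hz⟩ <;>
        simp only [cellPoint] <;> push_cast <;> linarith
    have hside (i : ℤ) {j₁ j₂ j₃ : ℤ} {z₁ z₂ z₃ : ℝ} (h₁ : j₁ = j ∨ j₁ = j - 1)
        (h₂ : j₂ = j ∨ j₂ = j - 1) (h₃ : j₃ = j ∨ j₃ = j - 1) (h₁' : z₁ ∈ Set.Icc (1 / 2) 2)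
        (h₂' : z₂ ∈ Set.Icc (1 / 2) 2) (h₃' : z₃ ∈ Set.Icc (1 / 2) 2) :
        e (cellPoint i j₁ z₁) (cellPoint i j₂ z₂) * e (cellPoint i j₂ z₂) (cellPoint i j₃ z₃) =
          e (cellPoint i j₁ z₁) (cellPoint i j₃ z₃) :=
      he _ (convex_box ..) (D.col_above_free i j) _ (hmem i _ h₁ _ h₁') _ (hmem i _ h₂ _ h₂') _
        (hmem i _ h₃ _ h₃')
    have hsq {i₁ j₁ i₂ j₂ i₃ j₃ : ℤ} (h₁ : i₁ = i ∨ i₁ = i - 1) (h₁' : j₁ = j ∨ j₁ = j - 1)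
        (h₂ : i₂ = i ∨ i₂ = i - 1) (h₂' : j₂ = j ∨ j₂ = j - 1)
        (h₃ : i₃ = i ∨ i₃ = i - 1) (h₃' : j₃ = j ∨ j₃ = j - 1) :
        e (cellPoint i₁ j₁ (1 / 2)) (cellPoint i₂ j₂ (1 / 2)) *
          e (cellPoint i₂ j₂ (1 / 2)) (cellPoint i₃ j₃ (1 / 2)) =
          e (cellPoint i₁ j₁ (1 / 2)) (cellPoint i₃ j₃ (1 / 2)) := by
      have hmem (i' j' : ℤ) (hi : i' = i ∨ i' = i - 1) (hj : j' = j ∨ j' = j - 1) :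
          cellPoint i' j' (1 / 2) ∈
            box (i - 1 / 2) (i + 1 / 2) (j - 1 / 2) (j + 1 / 2) (1 / 2) (1 / 2) := by
        rcases hi with rfl | rfl <;> rcases hj with rfl | rfl <;>
          refine ⟨⟨?_, ?_⟩, ⟨?_, ?_⟩, ?_, ?_⟩ <;> simp only [cellPoint] <;> push_cast <;> linarith
      exact he _ (convex_box ..) (D.square_free i j h) _ (hmem _ _ h₁ h₁') _ (hmem _ _ h₂ h₂') _
        (hmem _ _ h₃ h₃')
    have hm : (1 / 2 : ℝ) ∈ Set.Icc (1 / 2) 2 := by norm_num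
    have ht : (2 : ℝ) ∈ Set.Icc (1 / 2) 2 := by norm_num
    -- It remains to compare the meridians of rows `j` and `j - 1`: their sides move above the
    -- horizontal edges, their bottom through the free square at height 1/2.
    rw [hV j, hV (j - 1), inv_mul_cancel_left, inv_mul_cancel_left,
      ← hup (-D.bound - 1) (-D.bound - 1) (i - 1) (j - 1) (i - 1) j,
      ← hup i j i (j - 1) (-D.bound - 1) (-D.bound - 1)]
    have h₁ : e (cellPoint (i - 1) (j - 1) 2) (cellPoint (i - 1) j 2) *
        e (cellPoint (i - 1) j 2) (cellPoint (i - 1) j (1 / 2)) =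
        e (cellPoint (i - 1) (j - 1) 2) (cellPoint (i - 1) (j - 1) (1 / 2)) *
          e (cellPoint (i - 1) (j - 1) (1 / 2)) (cellPoint (i - 1) j (1 / 2)) := by
      rw [hside _ (.inr rfl) (.inl rfl) (.inl rfl) ht ht hm,
        hside _ (.inr rfl) (.inr rfl) (.inl rfl) ht hm hm]
    have h₂ : e (cellPoint i j (1 / 2)) (cellPoint i j 2) *
        e (cellPoint i j 2) (cellPoint i (j - 1) 2) =
        e (cellPoint i j (1 / 2)) (cellPoint i (j - 1) (1 / 2)) *
          e (cellPoint i (j - 1) (1 / 2)) (cellPoint i (j - 1) 2) := by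
      rw [hside _ (.inl rfl) (.inl rfl) (.inr rfl) hm ht ht,
        hside _ (.inl rfl) (.inr rfl) (.inr rfl) hm hm ht]
    have h₃ : e (cellPoint (i - 1) (j - 1) (1 / 2)) (cellPoint (i - 1) j (1 / 2)) *
        e (cellPoint (i - 1) j (1 / 2)) (cellPoint i j (1 / 2)) *
        e (cellPoint i j (1 / 2)) (cellPoint i (j - 1) (1 / 2)) =
        e (cellPoint (i - 1) (j - 1) (1 / 2)) (cellPoint i (j - 1) (1 / 2)) := by
      rw [hsq (.inr rfl) (.inr rfl) (.inr rfl) (.inl rfl) (.inl rfl) (.inl rfl),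
        hsq (.inr rfl) (.inr rfl) (.inl rfl) (.inl rfl) (.inl rfl) (.inr rfl)]
    rw [← h₃]
    generalize e (cellPoint (-D.bound - 1) (-D.bound - 1) 2) (cellPoint (i - 1) (j - 1) 2) = x₁
    generalize e (cellPoint i (j - 1) 2) (cellPoint (-D.bound - 1) (-D.bound - 1) 2) = x₂
    simp only [mul_assoc] at h₁ h₂ ⊢
    rw [reassoc h₁, reassoc h₂]
  · rcases h with h | h | h | h
    · exact hleft i j h
    · have hC : Convex ℝ {p : ℝ × ℝ × ℝ | D.bound < p.1} :=
        convex_halfSpace_gt (f := fun p : ℝ × ℝ × ℝ => p.1) ⟨by simp, by simp⟩ _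
      have hmem (j : ℤ) (z : ℝ) : cellPoint i j z ∈ {p : ℝ × ℝ × ℝ | (D.bound : ℝ) < p.1} := by
        have : (D.bound : ℝ) ≤ i := by exact_mod_cast h
        simp only [cellPoint, Set.mem_ofPred_eq]; linarith
      rw [hmove hC D.right_free i j i (-D.bound - 1) (hmem _ _) (hmem _ _) (hmem _ _) (hmem _ _)]
      exact hfront _ _ (by omega)
    · exact hfront i j h
    · have hC : Convex ℝ {p : ℝ × ℝ × ℝ | D.bound < p.2.1} :=
        convex_halfSpace_gt (f := fun p : ℝ × ℝ × ℝ => p.2.1) ⟨by simp, by simp⟩ _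
      have hmem (i : ℤ) (z : ℝ) : cellPoint i j z ∈ {p : ℝ × ℝ × ℝ | (D.bound : ℝ) < p.2.1} := by
        have : (D.bound : ℝ) ≤ j := by exact_mod_cast h
        simp only [cellPoint, Set.mem_ofPred_eq]; linarith
      rw [hmove hC D.back_free i j (-D.bound - 1) j (hmem _ _) (hmem _ _) (hmem _ _) (hmem _ _)]
      exact hleft _ _ (by omega)

end Cells

end GridDiagram

end TwistKnot

/-! ### Three charts and their gauge functions on the complement of a diagram. -/

namespace TwistKnot

open Topology Filter

/-- The charts of the gluing data of a grid diagram. -/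
inductive Chart
  | upper
  | lower
  | crossing

namespace GridDiagram

variable (D : GridDiagram)

/-- The region below the vertical edges, closed off by a slab. -/
def floorSet : Set (ℝ × ℝ × ℝ) :=
  {p | (p.1 ∈ Set.Icc (-(D.bound : ℝ)) D.bound ∧ p.2.1 ∈ Set.Icc (-(D.bound : ℝ)) D.bound ∧
      p.2.2 ∈ Set.Icc (-1 / 2 : ℝ) 0) ∨
    ((0 ≤ p.2.2 ∧ p.2.2 ≤ 1) ∧
      ∃ i j : ℤ, D.vert i j ∧ p.1 = i ∧ (j : ℝ) ≤ p.2.1 ∧ p.2.1 ≤ j + 1)}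

/-- The region above the horizontal edges. -/
def wallSet : Set (ℝ × ℝ × ℝ) :=
  {p | 0 ≤ p.2.2 ∧ ∃ i j : ℤ, D.horiz i j ∧ p.2.1 = j ∧ (i : ℝ) ≤ p.1 ∧ p.1 ≤ i + 1}

/-- The domains of the charts; the domain of the upper one is the complement of a compact set. -/
def chartSet : Chart → Set (ℝ × ℝ × ℝ)
  | .upper => D.floorSetᶜ
  | .lower => {p | (-(D.bound : ℝ) - 1 < p.1 ∧ p.1 < D.bound + 1) ∧
      (-(D.bound : ℝ) - 1 < p.2.1 ∧ p.2.1 < D.bound + 1) ∧ -2 < p.2.2 ∧ p.2.2 < 1} \ D.wallSet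
  | .crossing => {p | (0 < p.2.2 ∧ p.2.2 < 1) ∧ ∃ i j : ℤ, ¬ D.post i j ∧
      ((i : ℝ) - 1 / 2 < p.1 ∧ p.1 < i + 1 / 2) ∧ (j : ℝ) - 1 / 2 < p.2.1 ∧ p.2.1 < j + 1 / 2}

theorem isCompact_floorSet : IsCompact D.floorSet := by
  have h₁ : IsCompact {p : ℝ × ℝ × ℝ | p.1 ∈ Set.Icc (-(D.bound : ℝ)) D.bound ∧
      p.2.1 ∈ Set.Icc (-(D.bound : ℝ)) D.bound ∧ p.2.2 ∈ Set.Icc (-1 / 2 : ℝ) 0} :=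
    isCompact_Icc.prod (isCompact_Icc.prod isCompact_Icc)
  have hfin : {q : ℤ × ℤ | D.vert q.1 q.2}.Finite := by
    refine ((Set.finite_Icc (-D.bound) D.bound).prod (Set.finite_Icc (-D.bound) D.bound)).subset ?_
    rintro ⟨i, j⟩ h
    have := D.vert_bound i j h
    exact ⟨⟨this.1.1, this.1.2⟩, ⟨this.2.1, by omega⟩⟩
  have h₂ : IsCompact (⋃ q ∈ {q : ℤ × ℤ | D.vert q.1 q.2},
      box (q.1 : ℝ) q.1 (q.2 : ℝ) (q.2 + 1) 0 1) :=
    hfin.isCompact_biUnion fun q _ => isCompact_Icc.prod (isCompact_Icc.prod isCompact_Icc)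
  convert h₁.union h₂ using 1
  ext ⟨x, y, z⟩
  simp only [floorSet, Set.mem_union, Set.mem_ofPred_eq, Set.mem_iUnion, Set.mem_prod, Set.mem_Icc,
    exists_prop, Prod.exists]
  constructor
  · rintro (h | ⟨h, i, j, hv, rfl, hy⟩)
    · exact .inl h
    · exact .inr ⟨i, j, hv, ⟨le_rfl, le_rfl⟩, hy, h⟩
  · rintro (h | ⟨i, j, hv, hx, hy, h⟩)
    · exact .inl h
    · exact .inr ⟨h, i, j, hv, le_antisymm hx.2 hx.1, hy⟩

theorem isClosed_wallSet : IsClosed D.wallSet := by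
  have hfin : {q : ℤ × ℤ | D.horiz q.1 q.2}.Finite := by
    refine ((Set.finite_Icc (-D.bound) D.bound).prod (Set.finite_Icc (-D.bound) D.bound)).subset ?_
    rintro ⟨i, j⟩ h
    have := D.horiz_bound i j h
    exact ⟨⟨this.1.1, by omega⟩, ⟨this.2.1, this.2.2⟩⟩
  have h₂ : IsClosed (⋃ q ∈ {q : ℤ × ℤ | D.horiz q.1 q.2},
      (Set.Icc (q.1 : ℝ) (q.1 + 1) ×ˢ ({(q.2 : ℝ)} : Set ℝ) ×ˢ Set.Ici (0 : ℝ))) :=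
    hfin.isClosed_biUnion fun q _ => isClosed_Icc.prod (isClosed_singleton.prod isClosed_Ici)
  convert h₂ using 1
  ext ⟨x, y, z⟩
  simp only [wallSet, Set.mem_ofPred_eq, Set.mem_iUnion, Set.mem_prod, Set.mem_Icc,
    exists_prop, Prod.exists, Set.mem_singleton_iff, Set.mem_Ici]
  constructor
  · rintro ⟨h, i, j, hv, hy, hx⟩
    exact ⟨i, j, hv, hx, hy, h⟩
  · rintro ⟨i, j, hv, hx, hy, h⟩
    exact ⟨h, i, j, hv, hy, hx⟩

theorem isOpen_chartSet (c : Chart) : IsOpen (D.chartSet c) := by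
  cases c with
  | upper => exact D.isCompact_floorSet.isClosed.isOpen_compl
  | lower =>
    refine IsOpen.sdiff ?_ D.isClosed_wallSet
    exact isOpen_Ioo.prod (isOpen_Ioo.prod isOpen_Ioo)
  | crossing =>
    have : IsOpen (⋃ q ∈ {q : ℤ × ℤ | ¬ D.post q.1 q.2},
        (Set.Ioo ((q.1 : ℝ) - 1 / 2) (q.1 + 1 / 2) ×ˢ
          Set.Ioo ((q.2 : ℝ) - 1 / 2) (q.2 + 1 / 2) ×ˢ Set.Ioo (0 : ℝ) 1)) :=
      isOpen_biUnion fun q _ => isOpen_Ioo.prod (isOpen_Ioo.prod isOpen_Ioo)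
    convert this using 1
    ext ⟨x, y, z⟩
    simp only [chartSet, Set.mem_ofPred_eq, Set.mem_iUnion, Set.mem_prod, Set.mem_Ioo,
      exists_prop, Prod.exists]
    constructor
    · rintro ⟨h, i, j, hv, hx, hy⟩
      exact ⟨i, j, hv, hx, hy, h⟩
    · rintro ⟨i, j, hv, hx, hy, h⟩
      exact ⟨h, i, j, hv, hx, hy⟩

/-- A point missed by the upper and lower charts lies strictly between a vertical edge and a
horizontal edge below it; off the link, that grid point is not a corner. -/
theorem exists_mem_chartSet {p : ℝ × ℝ × ℝ} (hp : p ∉ D.carrier) : ∃ c, p ∈ D.chartSet c := by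
  obtain ⟨x, y, z⟩ := p
  by_cases hA : (x, y, z) ∈ D.floorSet
  swap
  · exact ⟨.upper, hA⟩
  by_cases hB : (x, y, z) ∈ D.wallSet
  swap
  · refine ⟨.lower, ?_, hB⟩
    rcases hA with ⟨⟨hx₁, hx₂⟩, ⟨hy₁, hy₂⟩, hz₁, hz₂⟩ | ⟨⟨hz₁, hz₂⟩, i, j, hv, hx, hy₁, hy₂⟩
    · dsimp only at *
      refine ⟨⟨?_, ?_⟩, ⟨?_, ?_⟩, ?_, ?_⟩ <;> dsimp only <;> linarith
    · obtain ⟨⟨h₁, h₂⟩, h₃, h₄⟩ := D.vert_bound i j hv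
      have hz : z ≠ 1 := fun hz => hp (.inl ⟨hz, i, j, hv, hx, hy₁, hy₂⟩)
      have hz' := lt_of_le_of_ne hz₂ hz
      rify at h₁ h₂ h₃ h₄
      dsimp only at *
      refine ⟨⟨?_, ?_⟩, ⟨?_, ?_⟩, ?_, ?_⟩ <;> dsimp only <;> linarith
  · obtain ⟨hz₀, i', j', hh, hy', hx₁', hx₂'⟩ := hB
    have hz₀' : z ≠ 0 := fun hz => hp (.inr (.inl ⟨hz, i', j', hh, hy', hx₁', hx₂'⟩))
    have hz : 0 < z := lt_of_le_of_ne hz₀ hz₀'.symm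
    rcases hA with ⟨-, -, -, hz₂⟩ | ⟨⟨-, hz₂⟩, i, j, hv, hx, hy₁, hy₂⟩
    · exact absurd hz hz₂.not_gt
    have hz₁ : z ≠ 1 := fun hz => hp (.inl ⟨hz, i, j, hv, hx, hy₁, hy₂⟩)
    have hz' := lt_of_le_of_ne hz₂ hz₁
    dsimp only at *
    refine ⟨.crossing, ⟨hz, hz'⟩, i, j', fun hpost => hp ?_, ?_, ?_⟩
    · exact .inr (.inr ⟨⟨hz.le, hz'.le⟩, i, j', hpost, hx, hy'⟩)
    · constructor <;> dsimp only <;> linarith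
    · constructor <;> dsimp only <;> linarith

variable {H : Type*} [Group H] {P : ℤ → ℤ → H}

/-- The charts, in terms of a global discontinuous trivialization that agrees with the upper
chart. -/
noncomputable def gauge (P : ℤ → ℤ → H) : Chart → ℝ × ℝ × ℝ → H
  | .upper, _ => 1
  | .lower, p => if 0 < p.2.2 then P ⌊p.1⌋ ⌊p.2.1⌋ else 1
  | .crossing, p => (P (⌊p.1 + 1 / 2⌋ - 1) ⌊p.2.1⌋)⁻¹ * P ⌊p.1⌋ ⌊p.2.1⌋

theorem eventually_floor (x : ℝ) :
    ∀ᶠ y : ℝ in 𝓝 x, ⌊y⌋ = ⌊x⌋ ∨ (x = ⌊x⌋ ∧ ⌊y⌋ = ⌊x⌋ - 1) := by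
  have h₁ : ∀ᶠ y : ℝ in 𝓝 x, y < ⌊x⌋ + 1 := eventually_lt_nhds (Int.lt_floor_add_one x)
  rcases eq_or_lt_of_le (Int.floor_le x) with h | h
  · have h₂ : ∀ᶠ y : ℝ in 𝓝 x, (⌊x⌋ : ℝ) - 1 < y := eventually_gt_nhds (by linarith)
    filter_upwards [h₁, h₂] with y hy₁ hy₂
    by_cases hy : (⌊x⌋ : ℝ) ≤ y
    · exact .inl (Int.floor_eq_iff.2 ⟨hy, hy₁⟩)
    · refine .inr ⟨h.symm, Int.floor_eq_iff.2 ?_⟩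
      push_cast
      constructor <;> linarith
  · filter_upwards [h₁, eventually_gt_nhds h] with y hy₁ hy₂
    exact .inl (Int.floor_eq_iff.2 ⟨hy₂.le, hy₁⟩)

variable {D}

/-- The gauge jumps on passing height 0, but there the upper chart leaves only points outside the
bounding square, where labels are 1. Higher up, points of both charts avoid the vertical planes
below and above the edges, so nearby cells carry equal labels. -/
theorem IsFaceLabeling.eventually_gauge_lower (hP : D.IsFaceLabeling P) {p : ℝ × ℝ × ℝ}
    (h₁ : p ∈ D.chartSet .upper) (h₂ : p ∈ D.chartSet .lower) :
    ∀ᶠ q in 𝓝 p, gauge P .lower q = gauge P .lower p := by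
  obtain ⟨x, y, z⟩ := p
  have hfst : Tendsto (fun q : ℝ × ℝ × ℝ => q.1) (𝓝 (x, y, z)) (𝓝 x) := continuous_fst.tendsto _
  have hsnd : Tendsto (fun q : ℝ × ℝ × ℝ => q.2.1) (𝓝 (x, y, z)) (𝓝 y) :=
    (continuous_fst.comp continuous_snd).tendsto _
  have hthd : Tendsto (fun q : ℝ × ℝ × ℝ => q.2.2) (𝓝 (x, y, z)) (𝓝 z) :=
    (continuous_snd.comp continuous_snd).tendsto _
  rcases lt_trichotomy z 0 with hz | rfl | hz
  · filter_upwards [hthd.eventually (eventually_lt_nhds hz)] with q hq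
    simp only [gauge, if_neg hq.not_gt, if_neg hz.not_gt]
  · have h : ¬ (x ∈ Set.Icc (-(D.bound : ℝ)) D.bound ∧ y ∈ Set.Icc (-(D.bound : ℝ)) D.bound) :=
      fun h => h₁ (.inl ⟨h.1, h.2, by norm_num⟩)
    have hev : ∀ᶠ q : ℝ × ℝ × ℝ in 𝓝 (x, y, 0), ¬ (q.1 ∈ Set.Icc (-(D.bound : ℝ)) D.bound ∧
        q.2.1 ∈ Set.Icc (-(D.bound : ℝ)) D.bound) := by
      have hcl : IsClosed {q : ℝ × ℝ × ℝ | q.1 ∈ Set.Icc (-(D.bound : ℝ)) D.bound ∧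
          q.2.1 ∈ Set.Icc (-(D.bound : ℝ)) D.bound} :=
        (isClosed_Icc.preimage continuous_fst).inter
          (isClosed_Icc.preimage (continuous_fst.comp continuous_snd))
      exact hcl.isOpen_compl.mem_nhds h
    filter_upwards [hev] with q hq
    simp only [gauge, lt_irrefl, if_false]
    split_ifs with hz
    · apply hP.outer
      by_contra hc
      push Not at hc
      apply hq
      refine ⟨⟨?_, ?_⟩, ?_, ?_⟩
      · exact_mod_cast (Int.le_floor.1 hc.1)
      · exact (Int.floor_lt.1 hc.2.1).le
      · exact_mod_cast (Int.le_floor.1 hc.2.2.1)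
      · exact (Int.floor_lt.1 hc.2.2.2).le
    · rfl
  · have hz₁ : z < 1 := h₂.1.2.2.2
    have hv (i j : ℤ) (hx : x = i) (hy : (j : ℝ) ≤ y ∧ y ≤ j + 1) : ¬ D.vert i j :=
      fun h => h₁ (.inr ⟨⟨hz.le, hz₁.le⟩, i, j, h, hx, hy⟩)
    have hh (i j : ℤ) (hy : y = j) (hx : (i : ℝ) ≤ x ∧ x ≤ i + 1) : ¬ D.horiz i j :=
      fun h => h₂.2 ⟨hz.le, i, j, h, hy, hx⟩
    have hx₁ := Int.floor_le x
    have hx₂ := Int.lt_floor_add_one x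
    have hy₁ := Int.floor_le y
    have hy₂ := Int.lt_floor_add_one y
    filter_upwards [hfst.eventually (eventually_floor x), hsnd.eventually (eventually_floor y),
      hthd.eventually (eventually_gt_nhds hz)] with q hq₁ hq₂ hq₃
    simp only [gauge, if_pos hq₃, if_pos hz]
    rcases hq₁ with hq₁ | ⟨hx, hq₁⟩ <;> rcases hq₂ with hq₂ | ⟨hy, hq₂⟩ <;> rw [hq₁, hq₂]
    · exact hP.horiz _ _ (hh _ _ hy ⟨hx₁, hx₂.le⟩)
    · exact hP.vert _ _ (hv _ _ hx ⟨hy₁, hy₂.le⟩)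
    · rw [hP.horiz _ _ (hh _ _ hy ⟨by push_cast; linarith, by push_cast; linarith⟩)]
      exact hP.vert _ _ (hv _ _ hx ⟨hy₁, hy₂.le⟩)

theorem eventually_center {c : ℤ} {x : ℝ} (h₁ : (c : ℝ) - 1 / 2 < x) (h₂ : x < c + 1 / 2) :
    ∀ᶠ y : ℝ in 𝓝 x, ⌊y + 1 / 2⌋ = c := by
  filter_upwards [eventually_gt_nhds h₁, eventually_lt_nhds h₂] with y hy₁ hy₂
  rw [Int.floor_eq_iff]
  constructor <;> linarith

theorem floor_eq_of_center {c : ℤ} {x : ℝ} (h₁ : (c : ℝ) - 1 / 2 < x) (h₂ : x < c + 1 / 2) :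
    ⌊x⌋ = c ∨ ⌊x⌋ = c - 1 := by
  by_cases h : (c : ℝ) ≤ x
  · exact .inl (Int.floor_eq_iff.2 ⟨h, by linarith⟩)
  · refine .inr (Int.floor_eq_iff.2 ?_)
    push_cast
    constructor <;> linarith

theorem eq_of_center {c k : ℤ} {x : ℝ} (h₁ : (c : ℝ) - 1 / 2 < x) (h₂ : x < c + 1 / 2)
    (hx : x = k) : k = c :=
  int_eq_of_mem hx h₁.le h₂.le

/-- The quotient is the inverse label left of the crossing column, so only the row matters. The
lower chart excludes a horizontal edge on the side of the point; if that is the right side, the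
crossing relation transfers the equality to the left. -/
theorem IsFaceLabeling.eventually_gauge_crossing_mul_inv (hP : D.IsFaceLabeling P)
    {p : ℝ × ℝ × ℝ} (h₁ : p ∈ D.chartSet .lower) (h₂ : p ∈ D.chartSet .crossing) :
    ∀ᶠ q in 𝓝 p, gauge P .crossing q * (gauge P .lower q)⁻¹ =
      gauge P .crossing p * (gauge P .lower p)⁻¹ := by
  obtain ⟨x, y, z⟩ := p
  have hfst : Tendsto (fun q : ℝ × ℝ × ℝ => q.1) (𝓝 (x, y, z)) (𝓝 x) := continuous_fst.tendsto _
  have hsnd : Tendsto (fun q : ℝ × ℝ × ℝ => q.2.1) (𝓝 (x, y, z)) (𝓝 y) :=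
    (continuous_fst.comp continuous_snd).tendsto _
  have hthd : Tendsto (fun q : ℝ × ℝ × ℝ => q.2.2) (𝓝 (x, y, z)) (𝓝 z) :=
    (continuous_snd.comp continuous_snd).tendsto _
  obtain ⟨⟨hz, hz₁⟩, c, d, hpost, ⟨hc₁, hc₂⟩, hd₁, hd₂⟩ := h₂
  dsimp only at hz hz₁ hc₁ hc₂ hd₁ hd₂
  have hh (i j : ℤ) (hy : y = j) (hx : (i : ℝ) ≤ x ∧ x ≤ i + 1) : ¬ D.horiz i j :=
    fun h => h₁.2 ⟨hz.le, i, j, h, hy, hx⟩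
  have hx₁ := Int.floor_le x
  have hx₂ := Int.lt_floor_add_one x
  have hev := eventually_center hc₁ hc₂
  have hcx := hev.self_of_nhds
  filter_upwards [hfst.eventually hev, hsnd.eventually (eventually_floor y),
    hthd.eventually (eventually_gt_nhds hz)] with q hq₁ hq₂ hq₃
  simp only [gauge, if_pos hq₃, if_pos hz, hq₁, hcx, mul_inv_cancel_right, inv_inj]
  rcases hq₂ with hq₂ | ⟨hy, hq₂⟩ <;> rw [hq₂]
  have hyd := eq_of_center hd₁ hd₂ hy
  rw [hyd] at hy ⊢
  have hfree := hh _ _ hy ⟨hx₁, hx₂.le⟩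
  rcases floor_eq_of_center hc₁ hc₂ with hfl | hfl <;> rw [hfl] at hfree
  · have := hP.cross c d hpost
    rw [hP.horiz _ _ hfree] at this
    exact (inv_injective (mul_right_cancel this)).symm
  · exact hP.horiz _ _ hfree

/-- The gauge is 1 left of the column and the column's meridian on its right. The meridian is the
same on both sides of the row by the crossing relation, and is 1 where the upper chart allows
passage across the column. -/
theorem IsFaceLabeling.eventually_gauge_crossing (hP : D.IsFaceLabeling P) {p : ℝ × ℝ × ℝ}
    (h₁ : p ∈ D.chartSet .upper) (h₂ : p ∈ D.chartSet .crossing) :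
    ∀ᶠ q in 𝓝 p, gauge P .crossing q = gauge P .crossing p := by
  obtain ⟨x, y, z⟩ := p
  have hfst : Tendsto (fun q : ℝ × ℝ × ℝ => q.1) (𝓝 (x, y, z)) (𝓝 x) := continuous_fst.tendsto _
  have hsnd : Tendsto (fun q : ℝ × ℝ × ℝ => q.2.1) (𝓝 (x, y, z)) (𝓝 y) :=
    (continuous_fst.comp continuous_snd).tendsto _
  obtain ⟨⟨hz, hz₁⟩, c, d, hpost, ⟨hc₁, hc₂⟩, hd₁, hd₂⟩ := h₂
  dsimp only at hz hz₁ hc₁ hc₂ hd₁ hd₂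
  have hv (i j : ℤ) (hx : x = i) (hy : (j : ℝ) ≤ y ∧ y ≤ j + 1) : ¬ D.vert i j :=
    fun h => h₁ (.inr ⟨⟨hz.le, hz₁.le⟩, i, j, h, hx, hy⟩)
  have hy₁ := Int.floor_le y
  have hy₂ := Int.lt_floor_add_one y
  have hev := eventually_center hc₁ hc₂
  have hcx := hev.self_of_nhds
  filter_upwards [hfst.eventually hev, hfst.eventually (eventually_floor x),
    hsnd.eventually (eventually_floor y)] with q hq₀ hq₁ hq₂
  simp only [gauge, hq₀, hcx]
  have hcross (hy : y = ⌊y⌋) : (P (c - 1) (⌊y⌋ - 1))⁻¹ * P c (⌊y⌋ - 1) =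
      (P (c - 1) ⌊y⌋)⁻¹ * P c ⌊y⌋ := by
    rw [eq_of_center hd₁ hd₂ hy]
    exact (hP.cross c d hpost).symm
  rcases floor_eq_of_center hc₁ hc₂ with hfl | hfl <;> rw [hfl] at hq₁ ⊢
  · rcases hq₁ with hq₁ | ⟨hx, hq₁⟩ <;> rcases hq₂ with hq₂ | ⟨hy, hq₂⟩ <;> rw [hq₁, hq₂]
    · exact hcross hy
    · rw [hP.vert _ _ (hv _ _ hx ⟨hy₁, hy₂.le⟩), inv_mul_cancel]
    · rw [hP.vert _ _ (hv _ _ hx ⟨hy₁, hy₂.le⟩), inv_mul_cancel, inv_mul_cancel]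
  · rcases hq₁ with hq₁ | ⟨hx, hq₁⟩
    · rw [hq₁, inv_mul_cancel, inv_mul_cancel]
    · exfalso
      push_cast at hx
      linarith

theorem IsFaceLabeling.eventually_gauge (hP : D.IsFaceLabeling P) (c d : Chart) {p : ℝ × ℝ × ℝ}
    (h₁ : p ∈ D.chartSet c) (h₂ : p ∈ D.chartSet d) :
    ∀ᶠ q in 𝓝 p, gauge P d q * (gauge P c q)⁻¹ = gauge P d p * (gauge P c p)⁻¹ := by
  have hinv {c d : Chart}
      (h : ∀ᶠ q in 𝓝 p, gauge P d q * (gauge P c q)⁻¹ = gauge P d p * (gauge P c p)⁻¹) :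
      ∀ᶠ q in 𝓝 p, gauge P c q * (gauge P d q)⁻¹ = gauge P c p * (gauge P d p)⁻¹ := by
    filter_upwards [h] with q hq
    simpa using congrArg (·⁻¹) hq
  have hul (h₁ : p ∈ D.chartSet .upper) (h₂ : p ∈ D.chartSet .lower) : ∀ᶠ q in 𝓝 p,
      gauge P .lower q * (gauge P .upper q)⁻¹ = gauge P .lower p * (gauge P .upper p)⁻¹ := by
    simpa only [gauge, inv_one, mul_one] using hP.eventually_gauge_lower h₁ h₂
  have huc (h₁ : p ∈ D.chartSet .upper) (h₂ : p ∈ D.chartSet .crossing) : ∀ᶠ q in 𝓝 p,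
      gauge P .crossing q * (gauge P .upper q)⁻¹ =
        gauge P .crossing p * (gauge P .upper p)⁻¹ := by
    simpa only [gauge, inv_one, mul_one] using hP.eventually_gauge_crossing h₁ h₂
  cases c <;> cases d
  · simp
  · exact hul h₁ h₂
  · exact huc h₁ h₂
  · exact hinv (hul h₂ h₁)
  · simp
  · exact hP.eventually_gauge_crossing_mul_inv h₁ h₂
  · exact hinv (huc h₂ h₁)
  · exact hinv (hP.eventually_gauge_crossing_mul_inv h₂ h₁)
  · simp

end GridDiagram

end TwistKnot

/-! ### Transfer to an ambient space, and the homomorphism of a labeling. -/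

namespace TwistKnot

open Topology Filter

namespace GridDiagram

variable {D : GridDiagram} {Q F : Type*}
  {P : ℤ → ℤ → Equiv.Perm F} {f : ℝ × ℝ × ℝ → Q} {K : Set Q}

variable (D f K) in
/-- The domains of the charts in the complement of the link in an ambient space `Q` in which
3-space is embedded. -/
def ambientChartSet : Chart → Set (Kᶜ : Set Q)
  | .upper => {x | x.1 ∉ f '' D.floorSet}
  | .lower => {x | x.1 ∈ f '' D.chartSet .lower}
  | .crossing => {x | x.1 ∈ f '' D.chartSet .crossing}

theorem mem_ambientChartSet_iff (hf : f.Injective) {c : Chart} {x : (Kᶜ : Set Q)} {p : ℝ × ℝ × ℝ}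
    (hx : x.1 = f p) : x ∈ D.ambientChartSet f K c ↔ p ∈ D.chartSet c := by
  cases c <;> simp only [ambientChartSet, Set.mem_ofPred_eq, hx, hf.mem_set_image]
  rfl

variable [TopologicalSpace Q] [T2Space Q]

/-- A labeling of a diagram by permutations is the gluing data of a covering space of the link
complement. -/
noncomputable def IsFaceLabeling.gluingData (hP : D.IsFaceLabeling P) (hf : IsOpenEmbedding f)
    (hK : K = f '' D.carrier) : GluingData Chart (Kᶜ : Set Q) F where
  U := D.ambientChartSet f K
  isOpen_U c := by
    cases c with
    | upper =>
      exact ((D.isCompact_floorSet.image hf.continuous).isClosed.isOpen_compl).preimage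
        continuous_subtype_val
    | lower => exact (hf.isOpenMap _ (D.isOpen_chartSet .lower)).preimage continuous_subtype_val
    | crossing =>
      exact (hf.isOpenMap _ (D.isOpen_chartSet .crossing)).preimage continuous_subtype_val
  exists_mem_U x := by
    by_cases hx : x.1 ∈ Set.range f
    · obtain ⟨p, hp⟩ := hx
      have hpD : p ∉ D.carrier := fun h =>
        x.2 (hp ▸ hK.ge (Set.mem_image_of_mem f h))
      obtain ⟨c, hc⟩ := D.exists_mem_chartSet hpD
      exact ⟨c, (mem_ambientChartSet_iff hf.injective hp.symm).2 hc⟩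
    · exact ⟨.upper, fun ⟨p, _, hp⟩ => hx ⟨p, hp⟩⟩
  g c x := gauge P c (Function.invFun f x.1)
  locallyConst := by
    intro c d x ⟨hc, hd⟩
    by_cases hx : x.1 ∈ Set.range f
    · obtain ⟨p, hp⟩ := hx
      rw [mem_ambientChartSet_iff hf.injective hp.symm] at hc hd
      have hinv := Function.leftInverse_invFun hf.injective
      have h : ∀ᶠ q in 𝓝 x.1, gauge P d (Function.invFun f q) * (gauge P c (Function.invFun f q))⁻¹ =
          gauge P d p * (gauge P c p)⁻¹ := by
        rw [← hp, ← hf.map_nhds_eq, eventually_map]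
        simpa only [hinv _] using hP.eventually_gauge c d hc hd
      have h' := (continuous_subtype_val.tendsto x).eventually h
      rw [← hp, hinv]
      exact h'
    -- Off the image of `f` only the upper chart is present; its gauge is constantly 1, so the
    -- default value of `Function.invFun` is harmless.
    · have hup {c : Chart} (hc : x ∈ D.ambientChartSet f K c) : c = .upper := by
        cases c with
        | upper => rfl
        | lower => exact absurd (Set.image_subset_range _ _ hc) hx
        | crossing => exact absurd (Set.image_subset_range _ _ hc) hx
      rw [hup hc, hup hd]
      simp

variable (D f K) in
/-- The inclusion of the complement of a link in 3-space. -/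
def complementMap (hf : IsOpenEmbedding f) (hK : K = f '' D.carrier) :
    C((D.carrierᶜ : Set (ℝ × ℝ × ℝ)), (Kᶜ : Set Q)) where
  toFun p := ⟨f p, fun h => p.2 (hf.injective.mem_set_image.1 (hK.le h))⟩
  continuous_toFun := (hf.continuous.comp continuous_subtype_val).subtype_mk _

theorem segment_subset_box {i j : ℤ} {z₁ z₂ : ℝ} (h : z₁ ≤ z₂) :
    segment ℝ (cellPoint i j z₁) (cellPoint i j z₂) ⊆
      box (i + 1 / 2) (i + 1 / 2) (j + 1 / 2) (j + 1 / 2) z₁ z₂ :=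
  (convex_box ..).segment_subset ⟨⟨le_rfl, le_rfl⟩, ⟨le_rfl, le_rfl⟩, le_rfl, h⟩
    ⟨⟨le_rfl, le_rfl⟩, ⟨le_rfl, le_rfl⟩, h, le_rfl⟩

/-- The homomorphism from the link group to a permutation group given by a face labeling. -/
theorem IsFaceLabeling.exists_hom [PathConnectedSpace (Kᶜ : Set Q)] (hP : D.IsFaceLabeling P)
    (hf : IsOpenEmbedding f) (hK : K = f '' D.carrier) (x₀ : (Kᶜ : Set Q)) :
    ∃ (Φ : FundamentalGroup (Kᶜ : Set Q) x₀ →* Equiv.Perm F) (m : Equiv.Perm F),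
      ∀ i j, (-D.bound ≤ i ∧ i < D.bound) → (-D.bound ≤ j ∧ j < D.bound) →
        Φ (D.cellElement (edgeElement (complementMap D f K hf hK) x₀) i j) = m⁻¹ * P i j * m := by
  obtain ⟨Φ, m, hΦ⟩ :=
    (hP.gluingData hf hK).exists_hom (complementMap D f K hf hK) x₀
  refine ⟨Φ, m (cellPoint (-D.bound - 1) (-D.bound - 1) 2), fun i j hi hj => ?_⟩
  set e := edgeElement (complementMap D f K hf hK) x₀
  have hinv := Function.leftInverse_invFun hf.injective
  have hΦ' (c : Chart) (a b : ℝ × ℝ × ℝ) (h : segment ℝ a b ⊆ D.carrierᶜ)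
      (h' : segment ℝ a b ⊆ D.chartSet c) :
      Φ (e a b) = (m a)⁻¹ * (gauge P c a)⁻¹ * gauge P c b * m b := by
    rw [hΦ c a b h fun p hp => (mem_ambientChartSet_iff hf.injective rfl).2 (h' hp)]
    simp only [IsFaceLabeling.gluingData, complementMap, ContinuousMap.coe_mk, hinv _]
  have hupper : Convex ℝ {p : ℝ × ℝ × ℝ | 1 < p.2.2} :=
    convex_halfSpace_gt (f := fun p : ℝ × ℝ × ℝ => p.2.2) ⟨by simp, by simp⟩ 1
  have hlower : Convex ℝ {p : ℝ × ℝ × ℝ | p.2.2 < -1 / 2} :=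
    convex_halfSpace_lt (f := fun p : ℝ × ℝ × ℝ => p.2.2) ⟨by simp, by simp⟩ _
  have hleft : Convex ℝ {p : ℝ × ℝ × ℝ | p.1 < -D.bound} :=
    convex_halfSpace_lt (f := fun p : ℝ × ℝ × ℝ => p.1) ⟨by simp, by simp⟩ _
  have e₁ : Φ (e (cellPoint (-D.bound - 1) (-D.bound - 1) 2)
      (cellPoint (-D.bound - 1) (-D.bound - 1) (-1))) =
      (m (cellPoint (-D.bound - 1) (-D.bound - 1) 2))⁻¹ *
        m (cellPoint (-D.bound - 1) (-D.bound - 1) (-1)) := by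
    have hseg : segment ℝ (cellPoint (-D.bound - 1) (-D.bound - 1) 2)
        (cellPoint (-D.bound - 1) (-D.bound - 1) (-1)) ⊆ {p : ℝ × ℝ × ℝ | p.1 < -D.bound} :=
      hleft.segment_subset
        (by simp only [cellPoint, Set.mem_ofPred_eq]; push_cast; linarith)
        (by simp only [cellPoint, Set.mem_ofPred_eq]; push_cast; linarith)
    rw [hΦ' .upper _ _ (hseg.trans D.left_free)]
    · simp [gauge]
    · rintro p hp (⟨⟨hx, -⟩, -⟩ | ⟨-, i', j', hv, hx, -⟩)
      · exact (hseg hp).not_ge hx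
      · have h := hseg hp
        have h' := (D.vert_bound i' j' hv).1.1
        rify at h'
        simp only [Set.mem_ofPred_eq] at h
        linarith
  have e₂ : Φ (e (cellPoint (-D.bound - 1) (-D.bound - 1) (-1)) (cellPoint i j (-1))) =
      (m (cellPoint (-D.bound - 1) (-D.bound - 1) (-1)))⁻¹ * m (cellPoint i j (-1)) := by
    have hseg : segment ℝ (cellPoint (-D.bound - 1) (-D.bound - 1) (-1))
        (cellPoint i j (-1)) ⊆ {p : ℝ × ℝ × ℝ | p.2.2 < -1 / 2} :=
      hlower.segment_subset (by norm_num [cellPoint]) (by norm_num [cellPoint])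
    have hlt : ∀ p ∈ {p : ℝ × ℝ × ℝ | p.2.2 < -1 / 2}, p.2.2 < 0 := fun p hp => by
      simp only [Set.mem_ofPred_eq] at hp; linarith
    rw [hΦ' .upper _ _ fun p hp => D.lower_free (hlt p (hseg hp))]
    · simp [gauge]
    · rintro p hp (⟨-, -, hz, -⟩ | ⟨⟨hz, -⟩, -⟩)
      · exact (hseg hp).not_ge hz
      · exact (hlt p (hseg hp)).not_ge hz
  -- The only piece that crosses the slab. It lies in the lower chart and contributes the label; the
  -- other pieces lie in the upper chart.
  have e₃ : Φ (e (cellPoint i j (-1)) (cellPoint i j (1 / 2))) =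
      (m (cellPoint i j (-1)))⁻¹ * P i j * m (cellPoint i j (1 / 2)) := by
    have hseg := segment_subset_box (i := i) (j := j) (z₁ := -1) (z₂ := 1 / 2) (by norm_num)
    rw [hΦ' .lower]
    · have hi : ⌊(i : ℝ) + 1 / 2⌋ = i := by rw [Int.floor_eq_iff]; constructor <;> linarith
      have hj : ⌊(j : ℝ) + 1 / 2⌋ = j := by rw [Int.floor_eq_iff]; constructor <;> linarith
      simp only [gauge, cellPoint, hi, hj]
      norm_num
    · refine hseg.trans (subset_trans ?_ (D.line_free i j))
      exact Set.prod_mono subset_rfl (Set.prod_mono subset_rfl (Set.Icc_subset_Icc_right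
        (by norm_num)))
    · rintro p hp
      obtain ⟨⟨hx₁, hx₂⟩, ⟨hy₁, hy₂⟩, hz₁, hz₂⟩ := hseg hp
      obtain ⟨hi₁, hi₂⟩ := hi
      obtain ⟨hj₁, hj₂⟩ := hj
      rify at hi₁ hi₂ hj₁ hj₂
      refine ⟨⟨⟨?_, ?_⟩, ⟨?_, ?_⟩, ?_, ?_⟩, ?_⟩
      iterate 6 linarith
      rintro ⟨-, i', j', -, hy, -⟩
      exact half_ne_int (le_antisymm hy₂ hy₁) hy
  have e₄ : Φ (e (cellPoint i j (1 / 2)) (cellPoint i j 2)) =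
      (m (cellPoint i j (1 / 2)))⁻¹ * m (cellPoint i j 2) := by
    have hseg := segment_subset_box (i := i) (j := j) (z₁ := 1 / 2) (z₂ := 2) (by norm_num)
    rw [hΦ' .upper]
    · simp [gauge]
    · refine hseg.trans (subset_trans ?_ (D.line_free i j))
      exact Set.prod_mono subset_rfl (Set.prod_mono subset_rfl (Set.Icc_subset_Icc_left
        (by norm_num)))
    · rintro p hp
      obtain ⟨⟨hx₁, hx₂⟩, ⟨hy₁, hy₂⟩, hz₁, hz₂⟩ := hseg hp
      rintro (⟨-, -, -, hz⟩ | ⟨-, i', j', -, hx, -⟩)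
      · linarith
      · exact half_ne_int (le_antisymm hx₂ hx₁) hx
  have e₅ : Φ (e (cellPoint i j 2) (cellPoint (-D.bound - 1) (-D.bound - 1) 2)) =
      (m (cellPoint i j 2))⁻¹ * m (cellPoint (-D.bound - 1) (-D.bound - 1) 2) := by
    have hseg : segment ℝ (cellPoint i j 2) (cellPoint (-D.bound - 1) (-D.bound - 1) 2) ⊆
        {p : ℝ × ℝ × ℝ | 1 < p.2.2} :=
      hupper.segment_subset (by norm_num [cellPoint]) (by norm_num [cellPoint])
    rw [hΦ' .upper _ _ (hseg.trans D.upper_free)]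
    · simp [gauge]
    · rintro p hp (⟨-, -, -, hz⟩ | ⟨⟨-, hz⟩, -⟩)
      · have h := hseg hp
        simp only [Set.mem_ofPred_eq] at h
        linarith
      · exact (hseg hp).not_ge hz
  have e₆ : e (cellPoint i j (-1)) (cellPoint i j 2) =
      e (cellPoint i j (-1)) (cellPoint i j (1 / 2)) *
        e (cellPoint i j (1 / 2)) (cellPoint i j 2) := by
    refine (edgeElement_mul _ _ (convex_box ..) (D.line_free i j) ?_ ?_ ?_).symm <;>
      refine ⟨⟨?_, ?_⟩, ⟨?_, ?_⟩, ?_, ?_⟩ <;> norm_num [cellPoint]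
  unfold cellElement
  rw [e₆]
  simp only [map_mul, e₁, e₂, e₃, e₄, e₅]
  group

end GridDiagram

end TwistKnot

/-! ### The polygon as the link of the grid diagram. -/

namespace TwistKnot

open Topology Filter

section Polygon

theorem mem_segment_x {q : E3} {a b y z : ℝ} (hab : a ≤ b) :
    q ∈ segment ℝ (!₂[a, y, z] : E3) !₂[b, y, z] ↔
      (a ≤ q 0 ∧ q 0 ≤ b) ∧ q 1 = y ∧ q 2 = z := by
  constructor
  · rintro ⟨s, t, hs, ht, hst, rfl⟩
    simp only [PiLp.add_apply, PiLp.smul_apply, smul_eq_mul]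
    simp only [Matrix.cons_val]
    obtain rfl : t = 1 - s := by linarith
    refine ⟨⟨?_, ?_⟩, by ring, by ring⟩ <;> nlinarith
  · rintro ⟨h, rfl, rfl⟩
    have : q 0 ∈ segment ℝ a b := by rw [segment_eq_Icc hab]; exact h
    obtain ⟨s, t, hs, ht, hst, hq⟩ := this
    refine ⟨s, t, hs, ht, hst, ?_⟩
    ext i
    fin_cases i
    · simpa using hq
    · simp [← add_mul, hst]
    · simp [← add_mul, hst]

theorem mem_segment_y {q : E3} {a b x z : ℝ} (hab : a ≤ b) :
    q ∈ segment ℝ (!₂[x, a, z] : E3) !₂[x, b, z] ↔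
      (a ≤ q 1 ∧ q 1 ≤ b) ∧ q 0 = x ∧ q 2 = z := by
  constructor
  · rintro ⟨s, t, hs, ht, hst, rfl⟩
    simp only [PiLp.add_apply, PiLp.smul_apply, smul_eq_mul]
    simp only [Matrix.cons_val]
    obtain rfl : t = 1 - s := by linarith
    refine ⟨⟨?_, ?_⟩, by ring, by ring⟩ <;> nlinarith
  · rintro ⟨h, rfl, rfl⟩
    have : q 1 ∈ segment ℝ a b := by rw [segment_eq_Icc hab]; exact h
    obtain ⟨s, t, hs, ht, hst, hq⟩ := this
    refine ⟨s, t, hs, ht, hst, ?_⟩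
    ext i
    fin_cases i
    · simp [← add_mul, hst]
    · simpa using hq
    · simp [← add_mul, hst]

theorem mem_segment_z {q : E3} {a b x y : ℝ} (hab : a ≤ b) :
    q ∈ segment ℝ (!₂[x, y, a] : E3) !₂[x, y, b] ↔
      (a ≤ q 2 ∧ q 2 ≤ b) ∧ q 0 = x ∧ q 1 = y := by
  constructor
  · rintro ⟨s, t, hs, ht, hst, rfl⟩
    simp only [PiLp.add_apply, PiLp.smul_apply, smul_eq_mul]
    simp only [Matrix.cons_val]
    obtain rfl : t = 1 - s := by linarith
    refine ⟨⟨?_, ?_⟩, by ring, by ring⟩ <;> nlinarith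
  · rintro ⟨h, rfl, rfl⟩
    have : q 2 ∈ segment ℝ a b := by rw [segment_eq_Icc hab]; exact h
    obtain ⟨s, t, hs, ht, hst, hq⟩ := this
    refine ⟨s, t, hs, ht, hst, ?_⟩
    ext i
    fin_cases i
    · simp [← add_mul, hst]
    · simp [← add_mul, hst]
    · simpa using hq

theorem mem_rowEdge {q : E3} {r c₁ c₂ : ℝ} (h : c₁ ≤ c₂) :
    q ∈ rowEdge r c₁ c₂ ↔ (c₁ ≤ q 0 ∧ q 0 ≤ c₂) ∧ q 1 = r ∧ q 2 = 0 :=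
  mem_segment_x h

theorem mem_colEdge {q : E3} {c r₁ r₂ : ℝ} (h : r₁ ≤ r₂) :
    q ∈ colEdge c r₁ r₂ ↔ q 0 = c ∧ ((q 2 = 1 ∧ r₁ ≤ q 1 ∧ q 1 ≤ r₂) ∨
      ((0 ≤ q 2 ∧ q 2 ≤ 1) ∧ (q 1 = r₁ ∨ q 1 = r₂))) := by
  rw [colEdge, Set.mem_union, Set.mem_union, mem_segment_z zero_le_one, mem_segment_y h,
    segment_symm, mem_segment_z zero_le_one]
  tauto

theorem exists_unit_interval {a b : ℤ} {y : ℝ} (hab : a < b) (h₁ : (a : ℝ) ≤ y) (h₂ : y ≤ b) :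
    ∃ j : ℤ, (a ≤ j ∧ j < b) ∧ (j : ℝ) ≤ y ∧ y ≤ j + 1 := by
  rcases eq_or_lt_of_le h₂ with h | h
  -- At the right end the floor would be `b`, one interval too far.
  · refine ⟨b - 1, ⟨by omega, by omega⟩, ?_, ?_⟩ <;> push_cast <;> linarith
  · exact ⟨⌊y⌋, ⟨Int.le_floor.2 h₁, Int.floor_lt.2 h⟩, Int.floor_le y,
      (Int.lt_floor_add_one y).le⟩

/-- The coordinates of a point of Euclidean space. -/
def coords (q : E3) : ℝ × ℝ × ℝ := (q 0, q 1, q 2)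

namespace GridDiagram

variable {D : GridDiagram} {q : E3}

theorem coords_mem_carrier_of_colEdge {c r₁ r₂ : ℝ} (i j₁ j₂ : ℤ) (hq : q ∈ colEdge c r₁ r₂)
    (hc : c = i) (hr₁ : r₁ = j₁) (hr₂ : r₂ = j₂) (hj : j₁ < j₂)
    (hv : ∀ j, j₁ ≤ j ∧ j < j₂ → D.vert i j) (hp₁ : D.post i j₁) (hp₂ : D.post i j₂) :
    coords q ∈ D.carrier := by
  subst hc hr₁ hr₂
  rw [mem_colEdge (by exact_mod_cast hj.le)] at hq
  obtain ⟨hx, ⟨hz, hy₁, hy₂⟩ | ⟨hz, hy | hy⟩⟩ := hq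
  · obtain ⟨j, hj, hy⟩ := exists_unit_interval hj hy₁ hy₂
    exact .inl ⟨hz, i, j, hv j hj, hx, hy⟩
  · exact .inr (.inr ⟨hz, i, j₁, hp₁, hx, hy⟩)
  · exact .inr (.inr ⟨hz, i, j₂, hp₂, hx, hy⟩)

theorem coords_mem_carrier_of_rowEdge {r c₁ c₂ : ℝ} (j i₁ i₂ : ℤ) (hq : q ∈ rowEdge r c₁ c₂)
    (hr : r = j) (hc₁ : c₁ = i₁) (hc₂ : c₂ = i₂) (hi : i₁ < i₂)
    (hh : ∀ i, i₁ ≤ i ∧ i < i₂ → D.horiz i j) : coords q ∈ D.carrier := by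
  subst hr hc₁ hc₂
  rw [mem_rowEdge (by exact_mod_cast hi.le)] at hq
  obtain ⟨⟨hx₁, hx₂⟩, hy, hz⟩ := hq
  obtain ⟨i, hi, hx⟩ := exists_unit_interval hi hx₁ hx₂
  exact .inr (.inl ⟨hz, i, j, hh i hi, hy, hx⟩)

end GridDiagram

theorem mem_colEdge_of_vert {q : E3} {c r₁ r₂ : ℝ} {i j : ℤ} (j₁ j₂ : ℤ) (hz : q 2 = 1)
    (hx : q 0 = i) (hy : (j : ℝ) ≤ q 1 ∧ q 1 ≤ j + 1) (hc : c = i) (hr₁ : r₁ = j₁) (hr₂ : r₂ = j₂)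
    (hj₁ : j₁ ≤ j) (hj₂ : j < j₂) : q ∈ colEdge c r₁ r₂ := by
  subst hc hr₁ hr₂
  have h₁ : (j₁ : ℝ) ≤ j := by exact_mod_cast hj₁
  have h₂ : (j : ℝ) + 1 ≤ j₂ := by exact_mod_cast hj₂
  rw [mem_colEdge (by linarith)]
  exact ⟨hx, .inl ⟨hz, by linarith, by linarith⟩⟩

theorem mem_rowEdge_of_horiz {q : E3} {r c₁ c₂ : ℝ} {i j : ℤ} (i₁ i₂ : ℤ) (hz : q 2 = 0)
    (hy : q 1 = j) (hx : (i : ℝ) ≤ q 0 ∧ q 0 ≤ i + 1) (hr : r = j) (hc₁ : c₁ = i₁) (hc₂ : c₂ = i₂)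
    (hi₁ : i₁ ≤ i) (hi₂ : i < i₂) : q ∈ rowEdge r c₁ c₂ := by
  subst hr hc₁ hc₂
  have h₁ : (i₁ : ℝ) ≤ i := by exact_mod_cast hi₁
  have h₂ : (i : ℝ) + 1 ≤ i₂ := by exact_mod_cast hi₂
  rw [mem_rowEdge (by linarith)]
  exact ⟨⟨by linarith, by linarith⟩, hy, hz⟩

theorem mem_colEdge_of_post {q : E3} {c r₁ r₂ : ℝ} {i j : ℤ} (j₁ j₂ : ℤ) (hz : 0 ≤ q 2 ∧ q 2 ≤ 1)
    (hx : q 0 = i) (hy : q 1 = j) (hc : c = i) (hr₁ : r₁ = j₁) (hr₂ : r₂ = j₂) (hj : j₁ ≤ j₂)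
    (h : j = j₁ ∨ j = j₂) : q ∈ colEdge c r₁ r₂ := by
  subst hc hr₁ hr₂
  rw [mem_colEdge (by exact_mod_cast hj)]
  refine ⟨hx, .inr ⟨hz, ?_⟩⟩
  rcases h with rfl | rfl
  · exact .inl hy
  · exact .inr hy

theorem mem_negTwistPolygon {n : ℕ} (hn : 1 ≤ n) {q : E3} :
    q ∈ negTwistPolygon n ↔ coords q ∈ (twistDiagram n).carrier := by
  constructor
  · intro hq
    simp only [negTwistPolygon, Set.mem_union, Set.mem_iUnion, Finset.mem_Icc, exists_prop] at hq
    rcases hq with (((((((((((⟨k, hk, hq⟩ | ⟨k, hk, hq⟩) | hq) | hq) | hq) | hq) | hq) | hq) | hq) |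
      hq) | hq) | hq) | hq
    · refine GridDiagram.coords_mem_carrier_of_colEdge k (k - 1) (k + 1) hq (by push_cast; ring)
        (by push_cast; ring) (by push_cast; ring) (by omega) ?_ ?_ ?_ <;>
        intros <;> dsimp only [twistDiagram] <;> omega
    · refine GridDiagram.coords_mem_carrier_of_rowEdge k (k - 1) (k + 1) hq (by push_cast; ring)
        (by push_cast; ring) (by push_cast; ring) (by omega) ?_
      intros; dsimp only [twistDiagram]; omega
    · refine GridDiagram.coords_mem_carrier_of_rowEdge (2 * n) (2 * n - 1) (2 * n + 4) hq
        (by push_cast; ring) (by push_cast; ring) (by push_cast; ring) (by omega) ?_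
      intros; dsimp only [twistDiagram]; omega
    · refine GridDiagram.coords_mem_carrier_of_rowEdge (2 * n + 1) (2 * n) (2 * n + 2) hq
        (by push_cast; ring) (by push_cast; ring) (by push_cast; ring) (by omega) ?_
      intros; dsimp only [twistDiagram]; omega
    · refine GridDiagram.coords_mem_carrier_of_colEdge (2 * n + 2) (2 * n + 1) (2 * n + 3) hq
        (by push_cast; ring) (by push_cast; ring) (by push_cast; ring) (by omega) ?_ ?_ ?_ <;>
        intros <;> dsimp only [twistDiagram] <;> omega
    · refine GridDiagram.coords_mem_carrier_of_rowEdge (2 * n + 2) 0 (2 * n + 3) hq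
        (by push_cast; ring) (by push_cast; ring) (by push_cast; ring) (by omega) ?_
      intros; dsimp only [twistDiagram]; omega
    · refine GridDiagram.coords_mem_carrier_of_colEdge (2 * n + 3) (2 * n + 2) (2 * n + 4) hq
        (by push_cast; ring) (by push_cast; ring) (by push_cast; ring) (by omega) ?_ ?_ ?_ <;>
        intros <;> dsimp only [twistDiagram] <;> omega
    · refine GridDiagram.coords_mem_carrier_of_rowEdge (2 * n + 3) (2 * n + 2) (2 * n + 4) hq
        (by push_cast; ring) (by push_cast; ring) (by push_cast; ring) (by omega) ?_
      intros; dsimp only [twistDiagram]; omega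
    · refine GridDiagram.coords_mem_carrier_of_colEdge (2 * n + 4) (2 * n) (2 * n + 3) hq
        (by push_cast; ring) (by push_cast; ring) (by push_cast; ring) (by omega) ?_ ?_ ?_ <;>
        intros <;> dsimp only [twistDiagram] <;> omega
    · refine GridDiagram.coords_mem_carrier_of_colEdge 0 1 (2 * n + 2) hq
        (by push_cast; ring) (by push_cast; ring) (by push_cast; ring) (by omega) ?_ ?_ ?_ <;>
        intros <;> dsimp only [twistDiagram] <;> omega
    · refine GridDiagram.coords_mem_carrier_of_rowEdge (2 * n + 4) (-1) (2 * n + 3) hq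
        (by push_cast; ring) (by push_cast; ring) (by push_cast; ring) (by omega) ?_
      intros; dsimp only [twistDiagram]; omega
    · refine GridDiagram.coords_mem_carrier_of_colEdge (-1) 0 (2 * n + 4) hq
        (by push_cast; ring) (by push_cast; ring) (by push_cast; ring) (by omega) ?_ ?_ ?_ <;>
        intros <;> dsimp only [twistDiagram] <;> omega
    · refine GridDiagram.coords_mem_carrier_of_rowEdge 0 (-1) 1 hq
        (by push_cast; ring) (by push_cast; ring) (by push_cast; ring) (by omega) ?_
      intros; dsimp only [twistDiagram]; omega
  · intro hq
    simp only [negTwistPolygon, Set.mem_union, Set.mem_iUnion, Finset.mem_Icc, exists_prop]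
    rcases hq with ⟨hz, i, j, hv, hx, hy⟩ | ⟨hz, i, j, hh, hy, hx⟩ | ⟨hz, i, j, hp, hx, hy⟩
    · dsimp only [twistDiagram] at hv
      rcases hv with hv | ⟨rfl, hv⟩ | ⟨rfl, hv⟩ | ⟨rfl, hv⟩ | ⟨rfl, hv⟩ | ⟨rfl, hv⟩
      · obtain ⟨k, rfl⟩ := Int.eq_ofNat_of_zero_le (show 0 ≤ i by omega)
        have h : ∃ k, (1 ≤ k ∧ k ≤ 2 * n) ∧ q ∈ colEdge k (k - 1) (k + 1) :=
          ⟨k, by omega, mem_colEdge_of_vert (k - 1) (k + 1) hz hx hy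
            (by push_cast; ring) (by push_cast; ring) (by push_cast; ring) (by omega) (by omega)⟩
        simp only [h, true_or]
      · have h : q ∈ colEdge (2 * n + 2) (2 * n + 1) (2 * n + 3) := mem_colEdge_of_vert (2 * n + 1) (2 * n + 3) hz hx hy
          (by push_cast; ring) (by push_cast; ring) (by push_cast; ring) (by omega) (by omega)
        simp only [h, true_or, or_true]
      · have h : q ∈ colEdge (2 * n + 3) (2 * n + 2) (2 * n + 4) := mem_colEdge_of_vert (2 * n + 2) (2 * n + 4) hz hx hy
          (by push_cast; ring) (by push_cast; ring) (by push_cast; ring) (by omega) (by omega)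
        simp only [h, true_or, or_true]
      · have h : q ∈ colEdge (2 * n + 4) (2 * n) (2 * n + 3) := mem_colEdge_of_vert (2 * n) (2 * n + 3) hz hx hy
          (by push_cast; ring) (by push_cast; ring) (by push_cast; ring) (by omega) (by omega)
        simp only [h, true_or, or_true]
      · have h : q ∈ colEdge 0 1 (2 * n + 2) := mem_colEdge_of_vert 1 (2 * n + 2) hz hx hy
          (by push_cast; ring) (by push_cast; ring) (by push_cast; ring) (by omega) (by omega)
        simp only [h, true_or, or_true]
      · have h : q ∈ colEdge (-1) 0 (2 * n + 4) := mem_colEdge_of_vert 0 (2 * n + 4) hz hx hy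
          (by push_cast; ring) (by push_cast; ring) (by push_cast; ring) (by omega) (by omega)
        simp only [h, true_or, or_true]
    · dsimp only [twistDiagram] at hh
      rcases hh with hh | ⟨rfl, hh⟩ | ⟨rfl, hh⟩ | ⟨rfl, hh⟩ | ⟨rfl, hh⟩ | ⟨rfl, hh⟩ | ⟨rfl, hh⟩
      · obtain ⟨k, rfl⟩ := Int.eq_ofNat_of_zero_le (show 0 ≤ j by omega)
        have h : ∃ k, (1 ≤ k ∧ k ≤ 2 * n - 1) ∧ q ∈ rowEdge k (k - 1) (k + 1) :=
          ⟨k, by omega, mem_rowEdge_of_horiz (k - 1) (k + 1) hz hy hx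
            (by push_cast; ring) (by push_cast; ring) (by push_cast; ring) (by omega) (by omega)⟩
        simp only [h, true_or, or_true]
      · have h : q ∈ rowEdge (2 * n) (2 * n - 1) (2 * n + 4) := mem_rowEdge_of_horiz (2 * n - 1) (2 * n + 4) hz hy hx
          (by push_cast; ring) (by push_cast; ring) (by push_cast; ring) (by omega) (by omega)
        simp only [h, true_or, or_true]
      · have h : q ∈ rowEdge (2 * n + 1) (2 * n) (2 * n + 2) := mem_rowEdge_of_horiz (2 * n) (2 * n + 2) hz hy hx
          (by push_cast; ring) (by push_cast; ring) (by push_cast; ring) (by omega) (by omega)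
        simp only [h, true_or, or_true]
      · have h : q ∈ rowEdge (2 * n + 2) 0 (2 * n + 3) := mem_rowEdge_of_horiz 0 (2 * n + 3) hz hy hx
          (by push_cast; ring) (by push_cast; ring) (by push_cast; ring) (by omega) (by omega)
        simp only [h, true_or, or_true]
      · have h : q ∈ rowEdge (2 * n + 3) (2 * n + 2) (2 * n + 4) := mem_rowEdge_of_horiz (2 * n + 2) (2 * n + 4) hz hy hx
          (by push_cast; ring) (by push_cast; ring) (by push_cast; ring) (by omega) (by omega)
        simp only [h, true_or, or_true]
      · have h : q ∈ rowEdge (2 * n + 4) (-1) (2 * n + 3) := mem_rowEdge_of_horiz (-1) (2 * n + 3) hz hy hx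
          (by push_cast; ring) (by push_cast; ring) (by push_cast; ring) (by omega) (by omega)
        simp only [h, true_or, or_true]
      · have h : q ∈ rowEdge 0 (-1) 1 := mem_rowEdge_of_horiz (-1) 1 hz hy hx
          (by push_cast; ring) (by push_cast; ring) (by push_cast; ring) (by omega) (by omega)
        simp only [h, or_true]
    · dsimp only [twistDiagram] at hp
      rcases hp with hp | ⟨rfl, hp⟩ | ⟨rfl, hp⟩ | ⟨rfl, hp⟩ | ⟨rfl, hp⟩ | ⟨rfl, hp⟩
      · obtain ⟨k, rfl⟩ := Int.eq_ofNat_of_zero_le (show 0 ≤ i by omega)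
        have h : ∃ k, (1 ≤ k ∧ k ≤ 2 * n) ∧ q ∈ colEdge k (k - 1) (k + 1) :=
          ⟨k, by omega, mem_colEdge_of_post (k - 1) (k + 1) hz hx hy
            (by push_cast; ring) (by push_cast; ring) (by push_cast; ring) (by omega) (by omega)⟩
        simp only [h, true_or]
      · have h : q ∈ colEdge (2 * n + 2) (2 * n + 1) (2 * n + 3) := mem_colEdge_of_post (2 * n + 1) (2 * n + 3) hz hx hy
          (by push_cast; ring) (by push_cast; ring) (by push_cast; ring) (by omega) (by omega)
        simp only [h, true_or, or_true]
      · have h : q ∈ colEdge (2 * n + 3) (2 * n + 2) (2 * n + 4) := mem_colEdge_of_post (2 * n + 2) (2 * n + 4) hz hx hy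
          (by push_cast; ring) (by push_cast; ring) (by push_cast; ring) (by omega) (by omega)
        simp only [h, true_or, or_true]
      · have h : q ∈ colEdge (2 * n + 4) (2 * n) (2 * n + 3) := mem_colEdge_of_post (2 * n) (2 * n + 3) hz hx hy
          (by push_cast; ring) (by push_cast; ring) (by push_cast; ring) (by omega) (by omega)
        simp only [h, true_or, or_true]
      · have h : q ∈ colEdge 0 1 (2 * n + 2) := mem_colEdge_of_post 1 (2 * n + 2) hz hx hy
          (by push_cast; ring) (by push_cast; ring) (by push_cast; ring) (by omega) (by omega)
        simp only [h, true_or, or_true]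
      · have h : q ∈ colEdge (-1) 0 (2 * n + 4) := mem_colEdge_of_post 0 (2 * n + 4) hz hx hy
          (by push_cast; ring) (by push_cast; ring) (by push_cast; ring) (by omega) (by omega)
        simp only [h, true_or, or_true]

end Polygon

end TwistKnot

/-! ### Path connectedness of the complement in 3-space. -/

namespace TwistKnot

open Topology Filter Set

namespace GridDiagram

variable (D : GridDiagram)

theorem joinedIn_of_convex {C : Set (ℝ × ℝ × ℝ)} (hC : Convex ℝ C) (hCD : C ⊆ D.carrierᶜ)
    {p q : ℝ × ℝ × ℝ} (hp : p ∈ C) (hq : q ∈ C) : JoinedIn D.carrierᶜ p q :=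
  ((hC.isPathConnected ⟨p, hp⟩).joinedIn p hp q hq).mono hCD

theorem convex_upper : Convex ℝ {p : ℝ × ℝ × ℝ | 1 < p.2.2} :=
  convex_halfSpace_gt (LinearMap.snd ℝ ℝ ℝ ∘ₗ LinearMap.snd ℝ ℝ (ℝ × ℝ)).isLinear 1

theorem convex_lower : Convex ℝ {p : ℝ × ℝ × ℝ | p.2.2 < 0} :=
  convex_halfSpace_lt (LinearMap.snd ℝ ℝ ℝ ∘ₗ LinearMap.snd ℝ ℝ (ℝ × ℝ)).isLinear 0

theorem convex_right : Convex ℝ {p : ℝ × ℝ × ℝ | D.bound < p.1} :=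
  convex_halfSpace_gt (LinearMap.fst ℝ ℝ (ℝ × ℝ)).isLinear D.bound

theorem joinedIn_of_upper {p : ℝ × ℝ × ℝ} (hp : 1 < p.2.2) :
    JoinedIn D.carrierᶜ p (D.bound + 1, 0, 0) :=
  (D.joinedIn_of_convex convex_upper D.upper_free hp (q := (D.bound + 1, 0, 2))
    (show (1 : ℝ) < 2 from one_lt_two)).trans
    (D.joinedIn_of_convex D.convex_right D.right_free
      (show (D.bound : ℝ) < D.bound + 1 from lt_add_one _)
      (show (D.bound : ℝ) < D.bound + 1 from lt_add_one _))

theorem joinedIn_of_lower {p : ℝ × ℝ × ℝ} (hp : p.2.2 < 0) :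
    JoinedIn D.carrierᶜ p (D.bound + 1, 0, 0) :=
  (D.joinedIn_of_convex convex_lower D.lower_free hp (q := (D.bound + 1, 0, -1))
    (show (-1 : ℝ) < 0 from neg_one_lt_zero)).trans
    (D.joinedIn_of_convex D.convex_right D.right_free
      (show (D.bound : ℝ) < D.bound + 1 from lt_add_one _)
      (show (D.bound : ℝ) < D.bound + 1 from lt_add_one _))

variable {D}

/-- Rising vertically can newly meet only a vertical edge: a corner segment spans all heights in [0,
1], and horizontal edges lie at the bottom, so either would already contain the starting point. -/
theorem joinedIn_of_not_vert {x y z : ℝ} (hz₀ : 0 ≤ z) (hz₁ : z ≤ 1)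
    (hp : (x, y, z) ∉ D.carrier)
    (hv : ∀ i j, D.vert i j → x = i → (j : ℝ) ≤ y → y ≤ j + 1 → False) :
    JoinedIn D.carrierᶜ (x, y, z) (D.bound + 1, 0, 0) := by
  refine (D.joinedIn_of_convex (convex_box x x y y z 2) ?_ (q := (x, y, 2)) ?_ ?_).trans
    (D.joinedIn_of_upper one_lt_two)
  · rintro ⟨x', y', w⟩ ⟨hx', hy', hw, -⟩
    obtain rfl : x' = x := le_antisymm hx'.2 hx'.1
    obtain rfl : y' = y := le_antisymm hy'.2 hy'.1
    dsimp only at hw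
    rintro (⟨-, i, j, h, hx, hy₁, hy₂⟩ | ⟨hw₀, h⟩ | ⟨-, h⟩)
    · exact hv i j h hx hy₁ hy₂
    · dsimp only at hw₀
      exact hp (.inr (.inl ⟨by dsimp only; linarith, h⟩))
    · exact hp (.inr (.inr ⟨⟨hz₀, hz₁⟩, h⟩))
  · exact ⟨⟨le_rfl, le_rfl⟩, ⟨le_rfl, le_rfl⟩, le_rfl, by dsimp only; linarith⟩
  · exact ⟨⟨le_rfl, le_rfl⟩, ⟨le_rfl, le_rfl⟩, by dsimp only; linarith, le_rfl⟩

theorem joinedIn_of_not_horiz {x y z : ℝ} (hz₀ : 0 ≤ z) (hz₁ : z ≤ 1)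
    (hp : (x, y, z) ∉ D.carrier)
    (hh : ∀ i j, D.horiz i j → y = j → (i : ℝ) ≤ x → x ≤ i + 1 → False) :
    JoinedIn D.carrierᶜ (x, y, z) (D.bound + 1, 0, 0) := by
  refine (D.joinedIn_of_convex (convex_box x x y y (-1) z) ?_ (q := (x, y, -1)) ?_ ?_).trans
    (D.joinedIn_of_lower neg_one_lt_zero)
  · rintro ⟨x', y', w⟩ ⟨hx', hy', -, hw⟩
    obtain rfl : x' = x := le_antisymm hx'.2 hx'.1
    obtain rfl : y' = y := le_antisymm hy'.2 hy'.1
    dsimp only at hw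
    rintro (⟨hw₁, h⟩ | ⟨-, i, j, h, hy, hx₁, hx₂⟩ | ⟨-, h⟩)
    · dsimp only at hw₁
      exact hp (.inl ⟨by dsimp only; linarith, h⟩)
    · exact hh i j h hy hx₁ hx₂
    · exact hp (.inr (.inr ⟨⟨hz₀, hz₁⟩, h⟩))
  · exact ⟨⟨le_rfl, le_rfl⟩, ⟨le_rfl, le_rfl⟩, by dsimp only; linarith, le_rfl⟩
  · exact ⟨⟨le_rfl, le_rfl⟩, ⟨le_rfl, le_rfl⟩, le_rfl, by dsimp only; linarith⟩

theorem joinedIn_compl_carrier {p : ℝ × ℝ × ℝ} (hp : p ∉ D.carrier) :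
    JoinedIn D.carrierᶜ p (D.bound + 1, 0, 0) := by
  obtain ⟨x, y, z⟩ := p
  rcases lt_or_ge z 0 with hz₀ | hz₀
  · exact D.joinedIn_of_lower hz₀
  rcases lt_or_ge 1 z with hz₁ | hz₁
  · exact D.joinedIn_of_upper hz₁
  by_cases hv : ∀ i j, D.vert i j → x = i → (j : ℝ) ≤ y → y ≤ j + 1 → False
  · exact joinedIn_of_not_vert hz₀ hz₁ hp hv
  by_cases hh : ∀ i j, D.horiz i j → y = j → (i : ℝ) ≤ x → x ≤ i + 1 → False
  · exact joinedIn_of_not_horiz hz₀ hz₁ hp hh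
  push Not at hv hh
  obtain ⟨i, j, hij, hx, hy₁, hy₂, -⟩ := hv
  obtain ⟨i', j', hij', hy, hx₁, hx₂, -⟩ := hh
  have hz₀' : z ≠ 0 := fun h => hp (.inr (.inl ⟨h, i', j', hij', hy, hx₁, hx₂⟩))
  have hz₁' : z ≠ 1 := fun h => hp (.inl ⟨h, i, j, hij, hx, hy₁, hy₂⟩)
  -- Between the two strands of a crossing neither vertical direction is free; half a step sideways
  -- leads out from under the upper strand.
  have hfree : box i (i + 1 / 2) y y z z ⊆ D.carrierᶜ := by
    rintro ⟨x', y', w⟩ ⟨hx', hy', hw⟩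
    obtain rfl : w = z := le_antisymm hw.2 hw.1
    obtain rfl : y' = y := le_antisymm hy'.2 hy'.1
    dsimp only at hx'
    rintro (⟨h, -⟩ | ⟨h, -⟩ | ⟨-, k, l, h, hk, hl⟩)
    · exact hz₁' h
    · exact hz₀' h
    · obtain rfl := int_eq_of_mem hk (i := i) (by dsimp only; linarith [hx'.1]) hx'.2
      exact hp (.inr (.inr ⟨⟨hz₀, hz₁⟩, _, l, h, hx, hl⟩))
  have hp' : ((i : ℝ) + 1 / 2, y, z) ∈ box i (i + 1 / 2) y y z z :=
    ⟨⟨by dsimp only; linarith, le_rfl⟩, ⟨le_rfl, le_rfl⟩, le_rfl, le_rfl⟩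
  exact (D.joinedIn_of_convex (convex_box _ _ _ _ _ _) hfree
    ⟨⟨hx.ge, by dsimp only; linarith⟩, ⟨le_rfl, le_rfl⟩, le_rfl, le_rfl⟩ hp').trans
    (joinedIn_of_not_vert hz₀ hz₁ (hfree hp') fun k l _ hk _ _ => half_ne_int rfl hk)

end GridDiagram

end TwistKnot

/-! ### Stereographic projection and the complement in the 3-sphere. -/

namespace TwistKnot

open Topology Filter Set

section Stereographic

/-- The inverse stereographic projection, in coordinates. -/
noncomputable def stereoChart (p : ℝ × ℝ × ℝ) : S3 := invStereo !₂[p.1, p.2.1, p.2.2]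

theorem stereoChart_apply (p : ℝ × ℝ × ℝ) : (stereoChart p : EuclideanSpace ℝ (Fin 4)) =
    (p.1 ^ 2 + p.2.1 ^ 2 + p.2.2 ^ 2 + 1)⁻¹ •
      !₂[2 * p.1, 2 * p.2.1, 2 * p.2.2, p.1 ^ 2 + p.2.1 ^ 2 + p.2.2 ^ 2 - 1] := by
  have h : ‖(!₂[p.1, p.2.1, p.2.2] : E3)‖ ^ 2 = p.1 ^ 2 + p.2.1 ^ 2 + p.2.2 ^ 2 := by
    simp [EuclideanSpace.norm_sq_eq, Fin.sum_univ_three]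
  simp [stereoChart, invStereo, h]

theorem sum_sq_of_mem_sphere (q : S3) :
    q.1 0 ^ 2 + q.1 1 ^ 2 + q.1 2 ^ 2 + q.1 3 ^ 2 = 1 := by
  have h := mem_sphere_zero_iff_norm.1 q.2
  have h' := EuclideanSpace.norm_sq_eq q.1
  rw [h] at h'
  simpa [Fin.sum_univ_four] using h'.symm

theorem sum_sq_add_one_pos (p : ℝ × ℝ × ℝ) : 0 < p.1 ^ 2 + p.2.1 ^ 2 + p.2.2 ^ 2 + 1 := by
  positivity

theorem stereoChart_zero (p : ℝ × ℝ × ℝ) : (stereoChart p).1 0 =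
    (p.1 ^ 2 + p.2.1 ^ 2 + p.2.2 ^ 2 + 1)⁻¹ * (2 * p.1) := by
  simp [stereoChart_apply]

theorem stereoChart_one (p : ℝ × ℝ × ℝ) : (stereoChart p).1 1 =
    (p.1 ^ 2 + p.2.1 ^ 2 + p.2.2 ^ 2 + 1)⁻¹ * (2 * p.2.1) := by
  simp [stereoChart_apply]

theorem stereoChart_two (p : ℝ × ℝ × ℝ) : (stereoChart p).1 2 =
    (p.1 ^ 2 + p.2.1 ^ 2 + p.2.2 ^ 2 + 1)⁻¹ * (2 * p.2.2) := by
  simp [stereoChart_apply]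

theorem stereoChart_three (p : ℝ × ℝ × ℝ) : (stereoChart p).1 3 =
    (p.1 ^ 2 + p.2.1 ^ 2 + p.2.2 ^ 2 + 1)⁻¹ * (p.1 ^ 2 + p.2.1 ^ 2 + p.2.2 ^ 2 - 1) := by
  simp [stereoChart_apply]

theorem one_sub_stereoChart_three (p : ℝ × ℝ × ℝ) : 1 - (stereoChart p).1 3 =
    (p.1 ^ 2 + p.2.1 ^ 2 + p.2.2 ^ 2 + 1)⁻¹ * 2 := by
  rw [stereoChart_three]
  field_simp [(sum_sq_add_one_pos p).ne']
  ring

theorem continuous_sphere_apply (i : Fin 4) : Continuous fun q : S3 => q.1 i := by fun_prop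

/-- The inverse stereographic projection, as a homeomorphism onto the complement of the pole. -/
noncomputable def stereoHomeomorph : OpenPartialHomeomorph (ℝ × ℝ × ℝ) S3 where
  toFun := stereoChart
  invFun := fun q => (q.1 0 / (1 - q.1 3), q.1 1 / (1 - q.1 3), q.1 2 / (1 - q.1 3))
  source := univ
  target := {q | q.1 3 ≠ 1}
  map_source' := fun p _ h => by
    have := one_sub_stereoChart_three p
    rw [h, sub_self] at this
    exact (mul_pos (inv_pos.2 (sum_sq_add_one_pos p)) two_pos).ne this
  map_target' := fun _ _ => mem_univ _
  left_inv' := fun p _ => by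
    have := sum_sq_add_one_pos p
    dsimp only
    rw [one_sub_stereoChart_three, stereoChart_zero, stereoChart_one, stereoChart_two]
    ext <;> dsimp only <;> field_simp
  right_inv' := fun q hq => by
    have hq' : 1 - q.1 3 ≠ 0 := sub_ne_zero.2 (Ne.symm hq)
    have hs := sum_sq_of_mem_sphere q
    have hd : (q.1 0 / (1 - q.1 3)) ^ 2 + (q.1 1 / (1 - q.1 3)) ^ 2 +
        (q.1 2 / (1 - q.1 3)) ^ 2 + 1 = 2 / (1 - q.1 3) := by
      field_simp
      linear_combination hs
    apply Subtype.ext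
    ext i
    fin_cases i
    · refine (stereoChart_zero _).trans ?_
      dsimp only
      rw [hd]; field_simp; rfl
    · refine (stereoChart_one _).trans ?_
      dsimp only
      rw [hd]; field_simp; rfl
    · refine (stereoChart_two _).trans ?_
      dsimp only
      rw [hd]; field_simp; rfl
    · refine (stereoChart_three _).trans ?_
      dsimp only
      rw [← sub_eq_iff_eq_add.2 hd.symm, sub_add_cancel]
      change _ = q.1 3
      field_simp
      ring
  open_source := isOpen_univ
  open_target := isOpen_ne_fun (continuous_sphere_apply 3) continuous_const
  continuousOn_toFun := by
    refine Continuous.continuousOn (continuous_induced_rng.2 ?_)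
    change Continuous fun p => (stereoChart p : EuclideanSpace ℝ (Fin 4))
    simp_rw [stereoChart_apply]
    refine Continuous.smul (Continuous.inv₀ (by fun_prop) fun p => (sum_sq_add_one_pos p).ne') ?_
    fun_prop
  continuousOn_invFun := by
    have hd : ∀ q ∈ {q : S3 | q.1 3 ≠ 1}, 1 - q.1 3 ≠ 0 :=
      fun q hq => sub_ne_zero.2 (Ne.symm hq)
    have hdc : ContinuousOn (fun q : S3 => 1 - q.1 3) {q | q.1 3 ≠ 1} :=
      (continuous_const.sub (continuous_sphere_apply 3)).continuousOn
    exact ((continuous_sphere_apply 0).continuousOn.div hdc hd).prodMk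
      (((continuous_sphere_apply 1).continuousOn.div hdc hd).prodMk ((continuous_sphere_apply 2).continuousOn.div hdc hd))

theorem isOpenEmbedding_stereoChart : IsOpenEmbedding stereoChart :=
  stereoHomeomorph.isOpenEmbedding rfl

theorem mem_range_stereoChart {q : S3} (hq : q.1 3 ≠ 1) : q ∈ range stereoChart :=
  ⟨_, stereoHomeomorph.right_inv hq⟩


end Stereographic

theorem stdNegTwistKnot_eq {n : ℕ} (hn : 1 ≤ n) :
    stdNegTwistKnot n = stereoChart '' (twistDiagram n).carrier := by
  have hsc (q : E3) : stereoChart (coords q) = invStereo q := by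
    have : (!₂[q 0, q 1, q 2] : E3) = q := by ext i; fin_cases i <;> rfl
    exact congrArg invStereo this
  ext s
  constructor
  · rintro ⟨q, hq, rfl⟩
    exact ⟨coords q, (mem_negTwistPolygon hn).1 hq, hsc q⟩
  · rintro ⟨p, hp, rfl⟩
    exact ⟨!₂[p.1, p.2.1, p.2.2], (mem_negTwistPolygon hn).2 hp, rfl⟩

theorem isPathConnected_compl_image (D : GridDiagram) (hD : 0 ≤ D.bound) :
    IsPathConnected (stereoChart '' D.carrier)ᶜ := by
  have hinj := isOpenEmbedding_stereoChart.injective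
  have hsub : stereoChart '' D.carrierᶜ ⊆ (stereoChart '' D.carrier)ᶜ :=
    image_compl_subset hinj
  have hb : (0 : ℝ) ≤ D.bound := by exact_mod_cast hD
  have hbase : ((D.bound : ℝ) + 1, (0 : ℝ), (0 : ℝ)) ∈ D.carrierᶜ :=
    D.right_free (show (D.bound : ℝ) < D.bound + 1 from lt_add_one _)
  refine ⟨stereoChart (D.bound + 1, 0, 0), hsub (mem_image_of_mem _ hbase), fun {q} hq => ?_⟩
  by_cases hr : q ∈ range stereoChart
  · obtain ⟨p, rfl⟩ := hr
    have hp : p ∉ D.carrier := fun h => hq (mem_image_of_mem _ h)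
    exact ((GridDiagram.joinedIn_compl_carrier hp).symm.map
      isOpenEmbedding_stereoChart.continuous).mono hsub
  · have hq₃ : q.1 3 = 1 := by
      by_contra h
      exact hr (mem_range_stereoChart h)
    have hs := sum_sq_of_mem_sphere q
    rw [hq₃] at hs
    have hq₀ : q.1 0 = 0 := by nlinarith [sq_nonneg (q.1 0), sq_nonneg (q.1 1), sq_nonneg (q.1 2)]
    have hq₁ : q.1 1 = 0 := by nlinarith [sq_nonneg (q.1 0), sq_nonneg (q.1 1), sq_nonneg (q.1 2)]
    have hq₂ : q.1 2 = 0 := by nlinarith [sq_nonneg (q.1 0), sq_nonneg (q.1 1), sq_nonneg (q.1 2)]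
    have hb' : (D.bound : ℝ) + 1 ≠ 0 := by positivity
    -- The antipodal chart gives a coordinate along the first axis that is regular at infinity.
    have hpt (s : ℝ) (hs : s ≠ 0) : -stereoChart (-s, 0, 0) = stereoChart (s⁻¹, 0, 0) := by
      apply Subtype.ext
      change -(stereoChart (-s, 0, 0)).1 = _
      rw [stereoChart_apply, stereoChart_apply]
      ext i
      fin_cases i <;> simp <;> field_simp <;> ring
    have hpole : -stereoChart (-0, 0, 0) = q := by
      apply Subtype.ext
      change -(stereoChart (-0, 0, 0)).1 = _
      rw [stereoChart_apply]
      ext i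
      fin_cases i
      · simpa using hq₀.symm
      · simpa using hq₁.symm
      · simpa using hq₂.symm
      · simpa using hq₃.symm
    -- From the pole at t = 0 along the first axis to the base point at t = 1; for t > 0 the first
    -- coordinate is (bound + 1) / t, beyond the link.
    refine (JoinedIn.ofLine (f := fun t => -stereoChart (-(t * ((D.bound : ℝ) + 1)⁻¹), 0, 0))
      ?_ ?_ ?_ ?_).symm
    · refine Continuous.continuousOn (Continuous.neg
        (isOpenEmbedding_stereoChart.continuous.comp ?_))
      fun_prop
    · simpa using hpole
    · simpa using hpt ((D.bound : ℝ) + 1)⁻¹ (inv_ne_zero hb')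
    · rintro _ ⟨t, ⟨ht₀, ht₁⟩, rfl⟩
      rcases eq_or_ne t 0 with rfl | ht
      · simp only [zero_mul]
        rwa [hpole]
      · dsimp only
        rw [hpt _ (mul_ne_zero ht (inv_ne_zero hb'))]
        refine hsub (mem_image_of_mem _ (D.right_free ?_))
        change (D.bound : ℝ) < (t * ((D.bound : ℝ) + 1)⁻¹)⁻¹
        rw [mul_inv, inv_inv]
        have : 1 ≤ t⁻¹ := (one_le_inv₀ (lt_of_le_of_ne ht₀ ht.symm)).2 ht₁
        nlinarith

end TwistKnot

/-! ### Conclusion. -/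

namespace TwistKnot

open Topology

/-- The group of a knot that is the image of the standard twist knot diagram under an open embedding
of 3-space contains a generalized torsion element. -/
theorem exists_isGeneralizedTorsion {Q : Type*} [TopologicalSpace Q] [T2Space Q] {n : ℕ}
    (hn : 1 ≤ n) {f : ℝ × ℝ × ℝ → Q} (hf : IsOpenEmbedding f) {K : Set Q}
    (hK : K = f '' (twistDiagram n).carrier) (hc : IsPathConnected Kᶜ) (x₀ : (Kᶜ : Set Q)) :
    ∃ g : FundamentalGroup (Kᶜ : Set Q) x₀, IsGeneralizedTorsion g := by
  have := isPathConnected_iff_pathConnectedSpace.1 hc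
  set P := (twistDiagram n).cellElement
    (edgeElement (GridDiagram.complementMap (twistDiagram n) f K hf hK) x₀) with hPdef
  have hP : (twistDiagram n).IsFaceLabeling P :=
    GridDiagram.isFaceLabeling_cellElement _ _ fun C hC hCD a ha b hb c hc =>
      edgeElement_mul _ x₀ hC hCD ha hb hc
  refine ⟨(P (-1) 0)⁻¹ * P 0 1 * P (-1) 0 * (P 0 1)⁻¹, fun h => ?_,
    isConjProd_one_of_relation hn _ _ (hP.twist_relation hn rfl rfl)⟩
  -- The regular action turns the dihedral labels into permutations faithfully; the fiber of the
  -- covering is the group itself.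
  obtain ⟨Φ, m, hΦ⟩ := ((isFaceLabeling_dihedralLabel hn).map (MulAction.toPermHom
    (DihedralGroup (4 * n - 1)) (DihedralGroup (4 * n - 1)))).exists_hom hf hK x₀
  have ha := hΦ (-1) 0 (by dsimp only [twistDiagram]; omega) (by dsimp only [twistDiagram]; omega)
  have hu := hΦ 0 1 (by dsimp only [twistDiagram]; omega) (by dsimp only [twistDiagram]; omega)
  rw [← hPdef] at ha hu
  have h₁ := congrArg Φ h
  simp only [map_mul, map_inv, map_one, ha, hu] at h₁
  refine dihedralLabel_commutator_ne_one hn (MulAction.toPerm_injective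
    (α := DihedralGroup (4 * n - 1)) (β := DihedralGroup (4 * n - 1)) ?_)
  change MulAction.toPermHom _ _ _ = MulAction.toPermHom _ _ 1
  simp only [map_mul, map_inv, map_one]
  rw [← mul_left_cancel_iff (a := m⁻¹), ← mul_right_cancel_iff (a := m), mul_one, inv_mul_cancel,
    ← h₁]
  group

end TwistKnot

theorem theorem1 (n : ℕ) (hn : 1 ≤ n) (K : Set TwistKnot.S3) (hK : TwistKnot.IsNegTwistKnot n K)
    (x₀ : (Kᶜ : Set TwistKnot.S3)) :
    ∃ g : TwistKnot.KnotGroup K x₀, TwistKnot.IsGeneralizedTorsion g := by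
  -- Only the final homeomorphism of the isotopy matters: composed with the chart, it is an open
  -- embedding carrying the diagram to `K`.
  obtain ⟨F, -, -, hF⟩ := hK
  have hstd := TwistKnot.stdNegTwistKnot_eq hn
  refine TwistKnot.exists_isGeneralizedTorsion hn
    ((F 1).isOpenEmbedding.comp TwistKnot.isOpenEmbedding_stereoChart)
    (by rw [← hF, hstd, Set.image_comp]) ?_ x₀
  rw [← hF, hstd, ← Set.image_compl_eq (F 1).bijective]
  exact (TwistKnot.isPathConnected_compl_image _ (by dsimp only [TwistKnot.twistDiagram]; omega)).image
    (F 1).continuous
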